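/- Throughout, $\mathfrak H$ is a separable complex Hilbert space with scalar product $(\cdot,\cdot)$, and for $p\in(0,\infty]$ and a Hilbert space $\mathcal H$, $\mathfrak S_p(\mathcal H)$ is the Schatten–von Neumann class of compact operators on $\mathcal H$ whose singular values (eigenvalues of $(R^*R)^{1/2}$, counted with multiplicity) are $p$-summable; $\mathfrak S_\infty(\mathcal H)$ consists of all compact operators. **Definitions.** Let $S$ be a densely defined closed symmetric operator in $\mathfrak H$. A *$B$-generalized boundary triple* for $S^*$ is a triple $\{\mathcal H,\Gamma_0,\Gamma_1\}$ of a Hilbert space $\mathcal H$ and linear maps $\Gamma_0,\Gamma_1:\operatorname{dom}T\to\mathcal H$, where $T$ is an operator in $\mathfrak H$ with $\overline T=S^*$, such that $$(Tf,g)-(f,Tg)=(\Gamma_1f,\Gamma_0g)-(\Gamma_0f,\Gamma_1g),\qquad f,g\in\operatorname{dom}T,$$ $A_0:=T\upharpoonright\ker\Gamma_0$ is self-adjoint in $\mathfrak H$, and $\operatorname{ran}\Gamma_0=\mathcal H$. It is a *double $B$-generalized boundary triple* if in addition $A_1:=T\upharpoonright\ker\Gamma_1$ is self-adjoint and $\operatorname{ran}\Gamma_1=\mathcal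 H$. Its *Weyl function* is $M(z)=\Gamma_1\bigl(\Gamma_0\upharpoonright\ker(T-z)\bigr)^{-1}$, $z\in\rho(A_0)$. A *Nevanlinna function* is a holomorphic function $M:\mathbb C_+\to\mathcal B(\mathcal H)$ with $\operatorname{Im}M(z)=\frac1{2i}(M(z)-M(z)^*)\ge0$ for all $z\in\mathbb C_+$; it is *strict* if $\ker\operatorname{Im}M(z)=\{0\}$ for all $z\in\mathbb C_+$ (equivalently, for some $z\in\mathbb C_+$). It is *$\mathfrak S_p$-regular* if $M(z)=C+K(z)$, $z\in\mathbb C_+$, with a self-adjoint, boundedly invertible $C\in\mathcal B(\mathcal H)$ and a strict Nevanlinna function $K$ with $K(z)\in\mathfrak S_p(\mathcal H)$ for all $z\in\mathbb C_+$. **Proposition.** Let $A$ and $B$ be self-adjoint operators in $\mathfrak H$ and assume that the closed symmetric operator $S=A\cap B$ (the operator whose graph is the intersection of the graphs of $A$ and $B$) is densely defined. Then $\operatorname{dom}A+\operatorname{dom}B$ is dense in $\operatorname{dom}S^*$ with respect to the graph norm of $S^*$, and the following assertions hold. (i) There is a $B$-generalized boundary triple $\{\mathcal H,\Gamma_0,\Gamma_1\}$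 for $S^*$ such that $$A=T\upharpoonright\ker\Gamma_0\qquad\text{and}\qquad B=T\upharpoonright\ker\Gamma_1.\tag{$*$}$$ (ii) If for some $z\in\mathbb C\setminus\mathbb R$ and some $p\in(0,\infty]$ $$(B-z)^{-1}-(A-z)^{-1}\in\mathfrak S_p(\mathfrak H),$$ then there exists a double $B$-generalized boundary triple $\{\mathcal H,\Gamma_0,\Gamma_1\}$ for $S^*$ such that $(*)$ holds and the corresponding Weyl function is $\mathfrak S_p$-regular (in particular $\mathcal B(\mathcal H)$-valued) on $\mathbb C_+$. -/

import Mathlib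

open scoped ENNReal ComplexInnerProductSpace

universe u v

noncomputable section

namespace BoundaryTriples

/-! ### Schatten-von Neumann classes -/

section Schatten

variable {E : Type u} [NormedAddCommGroup E] [InnerProductSpace ℂ E] [CompleteSpace E]

/-- The class `𝔖_p(E)`, `0 < p ≤ ∞`: compact operators `R` whose singular values, i.e. the
(nonzero) eigenvalues `s` of `|R| = (R* R)^{1/2}` counted with multiplicity, are `p`-summable.
For `p = ∞` these are the compact operators. -/
def MemSchatten (p : ℝ≥0∞) (R : E →L[ℂ] E) : Prop :=
  IsCompactOperator R ∧
    (p ≠ ∞ → Summable fun s : {s : ℝ // 0 < s} =>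
      (Module.finrank ℂ
        (Module.End.eigenspace ((CFC.abs R : E →L[ℂ] E) : Module.End ℂ E) ((s : ℝ) : ℂ)) : ℝ) *
          (s : ℝ) ^ p.toReal)

/-- A (partially defined) linear operator `L` is everywhere defined and bounded, and as an element
of `𝓑(E)` it is the operator `R`. -/
def IsBoundedOp (L : E →ₗ.[ℂ] E) (R : E →L[ℂ] E) : Prop :=
  L = (R : E →ₗ[ℂ] E).toPMap ⊤

/-- `L ∈ 𝔖_p(E)` for a linear operator `L` that is a priori only partially defined. -/
def OpMemSchatten (p : ℝ≥0∞) (L : E →ₗ.[ℂ] E) : Prop :=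
  ∃ R : E →L[ℂ] E, IsBoundedOp L R ∧ MemSchatten p R

end Schatten

/-! ### Unbounded operators -/

section Unbounded

variable {E : Type u} [NormedAddCommGroup E] [InnerProductSpace ℂ E]

/-- The operator `A - z`, with domain `dom A`. -/
def subScalar (A : E →ₗ.[ℂ] E) (z : ℂ) : E →ₗ.[ℂ] E :=
  (-(z • LinearMap.id) : E →ₗ[ℂ] E) +ᵥ A

/-- The operator `(A - z)⁻¹`, with domain `ran (A - z)` (meaningful when `A - z` is injective). -/
def resolventOp (A : E →ₗ.[ℂ] E) (z : ℂ) : E →ₗ.[ℂ] E :=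
  (subScalar A z).inverse

/-- The graph norm of `f ∈ dom T`. -/
def graphNorm (T : E →ₗ.[ℂ] E) (f : T.domain) : ℝ :=
  Real.sqrt (‖(f : E)‖ ^ 2 + ‖T f‖ ^ 2)

/-- `D` is a subspace of `dom T`, dense with respect to the graph norm of `T`. -/
def IsGraphDense (T : E →ₗ.[ℂ] E) (D : Submodule ℂ E) : Prop :=
  D ≤ T.domain ∧
    ∀ f : T.domain, ∀ ε : ℝ, 0 < ε → ∃ g : T.domain, (g : E) ∈ D ∧ graphNorm T (f - g) < ε

end Unbounded

/-! ### `B`-generalized boundary triples and their Weyl functions -/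

section Triples

variable {E : Type u} [NormedAddCommGroup E] [InnerProductSpace ℂ E]
variable {H : Type v} [NormedAddCommGroup H] [InnerProductSpace ℂ H]

/-- The restriction `T ↾ ker Γ` of `T` for a linear map `Γ : dom T → H`. -/
def restrictKer (T : E →ₗ.[ℂ] E) (Γ : T.domain →ₗ[ℂ] H) : E →ₗ.[ℂ] E :=
  T.domRestrict ((LinearMap.ker Γ).map T.domain.subtype)

open LinearPMap in
/-- `{H, Γ₀, Γ₁}`, with `Γ₀, Γ₁ : dom T → H`, is a `B`-generalized boundary triple for `S*`.
The scalar product `(x, y)`, linear in `x`, is `⟪y, x⟫` here. -/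
structure IsBGeneralizedBoundaryTriple [CompleteSpace E] (S T : E →ₗ.[ℂ] E)
    (Γ₀ Γ₁ : T.domain →ₗ[ℂ] H) : Prop where
  isClosable : T.IsClosable
  closure_eq : T.closure = S†
  green : ∀ f g : T.domain,
    ⟪(g : E), T f⟫ - ⟪T g, (f : E)⟫ = ⟪Γ₀ g, Γ₁ f⟫ - ⟪Γ₁ g, Γ₀ f⟫
  selfAdjoint_zero : IsSelfAdjoint (restrictKer T Γ₀)
  surjective_zero : Function.Surjective Γ₀

/-- `{H, Γ₀, Γ₁}` is a double `B`-generalized boundary triple for `S*`. -/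
structure IsDoubleBGeneralizedBoundaryTriple [CompleteSpace E] (S T : E →ₗ.[ℂ] E)
    (Γ₀ Γ₁ : T.domain →ₗ[ℂ] H) : Prop
    extends IsBGeneralizedBoundaryTriple S T Γ₀ Γ₁ where
  selfAdjoint_one : IsSelfAdjoint (restrictKer T Γ₁)
  surjective_one : Function.Surjective Γ₁

/-- `ker (T - z)`, as a subspace of `dom T`. -/
def kerSub (T : E →ₗ.[ℂ] E) (z : ℂ) : Submodule ℂ T.domain :=
  LinearMap.ker (T.toFun - z • T.domain.subtype)

/-- The `γ`-field `γ(z) = (Γ₀ ↾ ker (T - z))⁻¹`, as an operator from `H` to `dom T` with domain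
`Γ₀ (ker (T - z))`. -/
def gammaField (T : E →ₗ.[ℂ] E) (Γ₀ : T.domain →ₗ[ℂ] H) (z : ℂ) : H →ₗ.[ℂ] T.domain :=
  (Γ₀.toPMap (kerSub T z)).inverse

/-- The Weyl function `M(z) = Γ₁ γ(z)`, as an operator in `H`. -/
def weylFunction (T : E →ₗ.[ℂ] E) (Γ₀ Γ₁ : T.domain →ₗ[ℂ] H) (z : ℂ) : H →ₗ.[ℂ] H :=
  Γ₁.compPMap (gammaField T Γ₀ z)

end Triples

/-! ### Nevanlinna functions

Functions on the open upper half-plane are represented by functions on `ℂ`; only their values at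
points `z` with `0 < Im z` are used. -/

section Nevanlinna

variable {H : Type v} [NormedAddCommGroup H] [InnerProductSpace ℂ H] [CompleteSpace H]

/-- The imaginary part `(R - R*) / (2i)` of a bounded operator. -/
def imPart (R : H →L[ℂ] H) : H →L[ℂ] H :=
  ((2 * Complex.I)⁻¹ : ℂ) • (R - ContinuousLinearMap.adjoint R)

/-- The class `R[H]` of Nevanlinna functions. -/
structure IsNevanlinna (M : ℂ → H →L[ℂ] H) : Prop where
  holomorphic : DifferentiableOn ℂ M {z | 0 < z.im}
  im_nonneg : ∀ z : ℂ, 0 < z.im → (imPart (M z)).IsPositive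

/-- The class `R^s[H]` of strict Nevanlinna functions. -/
structure IsStrictNevanlinna (M : ℂ → H →L[ℂ] H) : Prop extends IsNevanlinna M where
  ker_im : ∀ z : ℂ, 0 < z.im → ∀ x : H, imPart (M z) x = 0 → x = 0

/-- `𝔖_p`-regular Nevanlinna functions: `M(z) = C + K(z)` with a bounded, boundedly invertible
self-adjoint `C` and a strict Nevanlinna function `K` with values in `𝔖_p`. -/
def IsSchattenRegular (p : ℝ≥0∞) (M : ℂ → H →L[ℂ] H) : Prop :=
  IsNevanlinna M ∧
    ∃ (C : H →L[ℂ] H) (K : ℂ → H →L[ℂ] H),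
      IsSelfAdjoint C ∧ IsUnit C ∧ IsStrictNevanlinna K ∧
      ∀ z : ℂ, 0 < z.im → MemSchatten p (K z) ∧ M z = C + K z

/-- The Weyl function has values in `𝓑(H)` on the upper half-plane and is `𝔖_p`-regular. -/
def HasSchattenRegularWeylFunction {E : Type u} [NormedAddCommGroup E] [InnerProductSpace ℂ E]
    (p : ℝ≥0∞) (T : E →ₗ.[ℂ] E) (Γ₀ Γ₁ : T.domain →ₗ[ℂ] H) : Prop :=
  ∃ M : ℂ → H →L[ℂ] H,
    (∀ z : ℂ, 0 < z.im → IsBoundedOp (weylFunction T Γ₀ Γ₁ z) (M z)) ∧ IsSchattenRegular p M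

end Nevanlinna

end BoundaryTriples

end

/-! Fix a nonreal z, let N = ker (S* - z) and let P be the orthogonal projection onto N. Relative to
A, the operator B is encoded by one bounded operator Q on N (`couplingOperator`): for a ∈ dom A and
u ∈ N, the pair (a + u, Aa + zu) lies in the graph of B iff u = Q P (A - z̄)a
(`add_mem_graph_right_iff`). Symmetry of B becomes Q - Q* = (z - z̄) Q*Q, and Q is injective with
dense range.

Both triples live on dom A + ran R for an injective bounded R with values in N, with Γ₀(a + Rk) = k
and Γ₁(a + Rk) = R*(A - z̄)a + Ck (`IsCoupling`). Green's identity then says C - C* = (z - z̄) R*R,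
and B = T ↾ ker Γ₁ says that the pairs (w, Rk) with R*w + Ck = 0 form the graph of Q. The closure of
T is S* because T extends A and B, and graph A + graph B is dense in graph S*
(`topologicalClosure_sup_graph`).

For (i) take R = Q, C = -Q*. For (ii), formally Q⁻¹ + c is self-adjoint whenever c - c̄ = z - z̄. As
Q is compact and the space separable, c can be chosen with 1 + cQ invertible, so D = (Q⁻¹ + c)⁻¹ =
Q(1 + cQ)⁻¹ is bounded, self-adjoint and injective. Write D = RJR with R = |D|^{1/2} and J a
self-adjoint unitary, and put C = cR² - J. The Weyl function is -J + R(…)R, so regularity reduces to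
showing RMR ∈ 𝔖_p for bounded M, given R² = JD = JQ(1 + cQ)⁻¹.

This last step is a count. For a compact operator the number of singular values above t controls,
and is controlled by, the rank needed to approximate within t; these counts determine p-summability
by the layer cake formula (`MemSchatten.of_isApproxByRank`). A rank n approximation of R² yields a
rank 2n approximation of RMR (`IsApproxByRank.sandwich`). -/

noncomputable section

namespace BoundaryTriples

/-! ### Approximation by operators of finite rank -/

section Approximation

variable {E : Type u} [NormedAddCommGroup E] [InnerProductSpace ℂ E]
variable {F : Type u} [NormedAddCommGroup F] [InnerProductSpace ℂ F]
variable {G : Type u} [NormedAddCommGroup G] [InnerProductSpace ℂ G]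

/-- `T` is within distance `ε` of an operator of rank at most `n`. -/
def IsApproxByRank (n : ℕ) (ε : ℝ) (T : E →L[ℂ] F) : Prop :=
  ∃ L : E →L[ℂ] F, LinearMap.rank (L : E →ₗ[ℂ] F) ≤ n ∧ ∀ x, ‖T x - L x‖ ≤ ε * ‖x‖

theorem IsApproxByRank.mono {n m : ℕ} {ε δ : ℝ} {T : E →L[ℂ] F} (h : IsApproxByRank n ε T)
    (hnm : n ≤ m) (hε : ε ≤ δ) : IsApproxByRank m δ T := by
  obtain ⟨L, hL, h⟩ := h
  exact ⟨L, hL.trans (by exact_mod_cast hnm), fun x => (h x).trans (by gcongr)⟩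

theorem IsApproxByRank.comp_left {n : ℕ} {ε : ℝ} {T : E →L[ℂ] F} (h : IsApproxByRank n ε T)
    (X : F →L[ℂ] G) : IsApproxByRank n (‖X‖ * ε) (X ∘L T) := by
  obtain ⟨L, hL, h⟩ := h
  refine ⟨X ∘L L, (LinearMap.rank_comp_le_right (L : E →ₗ[ℂ] F) (X : F →ₗ[ℂ] G)).trans hL,
    fun x => ?_⟩
  calc ‖X (T x) - X (L x)‖ = ‖X (T x - L x)‖ := by rw [map_sub]
    _ ≤ ‖X‖ * ‖T x - L x‖ := X.le_opNorm _
    _ ≤ ‖X‖ * (ε * ‖x‖) := by gcongr; exact h x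
    _ = _ := by ring

theorem IsApproxByRank.comp_right {n : ℕ} {ε : ℝ} {T : E →L[ℂ] F} (h : IsApproxByRank n ε T)
    (hε : 0 ≤ ε) (X : G →L[ℂ] E) : IsApproxByRank n (ε * ‖X‖) (T ∘L X) := by
  obtain ⟨L, hL, h⟩ := h
  refine ⟨L ∘L X, (LinearMap.rank_comp_le_left (X : G →ₗ[ℂ] E) (L : E →ₗ[ℂ] F)).trans hL,
    fun x => ?_⟩
  calc ‖T (X x) - L (X x)‖ ≤ ε * ‖X x‖ := h _
    _ ≤ ε * (‖X‖ * ‖x‖) := by gcongr; exact X.le_opNorm _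
    _ = _ := by ring

variable [CompleteSpace E]

/-- Approximating `R²` for a self-adjoint `R` yields approximations of `R M R`. -/
theorem IsApproxByRank.sandwich {n : ℕ} {ε : ℝ} {R : E →L[ℂ] E} (hR : IsSelfAdjoint R)
    (h : IsApproxByRank n ε (R ∘L R)) (hε : 0 ≤ ε) (M : E →L[ℂ] E) :
    IsApproxByRank (2 * n) (‖M‖ * ε) (R ∘L M ∘L R) := by
  obtain ⟨L, hL, h⟩ := h
  let N : Submodule ℂ E := LinearMap.ker (L : E →ₗ[ℂ] E)
  have hNc : IsClosed (N : Set E) := L.isClosed_ker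
  have : CompleteSpace N := hNc.completeSpace_coe
  let P : E →L[ℂ] E := N.starProjection
  have hP : ∀ x, P x ∈ N := fun x => N.starProjection_apply_mem x
  have hRi : ∀ x y, ⟪R x, y⟫ = ⟪x, R y⟫ := fun x y => hR.isSymmetric x y
  -- On ker L the operator R² has size at most ε, and ‖Rx‖² = (R²x, x); so R alone has size √ε
  -- there.
  have hsmall : ∀ x ∈ N, ‖R x‖ ≤ Real.sqrt ε * ‖x‖ := by
    intro x hx
    have h1 : ‖R x‖ ^ 2 ≤ ε * ‖x‖ ^ 2 := by
      have h2 : ‖R x‖ ^ 2 = Complex.re ⟪x, R (R x)⟫ := by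
        rw [← hRi, inner_self_eq_norm_sq_to_K]; norm_cast
      have h3 : L x = 0 := hx
      have h4 : ‖R (R x)‖ ≤ ε * ‖x‖ := by simpa [h3] using h x
      calc ‖R x‖ ^ 2 = Complex.re ⟪x, R (R x)⟫ := h2
        _ ≤ ‖⟪x, R (R x)⟫‖ := Complex.re_le_norm _
        _ ≤ ‖x‖ * ‖R (R x)‖ := norm_inner_le_norm _ _
        _ ≤ ‖x‖ * (ε * ‖x‖) := by gcongr
        _ = _ := by ring
    apply le_of_sq_le_sq _ (by positivity)
    rw [mul_pow, Real.sq_sqrt hε]; exact h1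
  -- `δ = R P` is the small part of `R`, the rest has rank at most `n`
  let δ : E →L[ℂ] E := R ∘L P
  have hδ : ‖δ‖ ≤ Real.sqrt ε := by
    refine δ.opNorm_le_bound (by positivity) fun x => ?_
    refine (hsmall _ (hP x)).trans ?_
    gcongr
    exact N.norm_starProjection_apply_le x
  have hPs : IsSelfAdjoint P := isSelfAdjoint_starProjection N
  let Z : E →L[ℂ] E := 1 - P
  have hZrank : LinearMap.rank (Z : E →ₗ[ℂ] E) ≤ n := by
    have h1 : LinearMap.range (Z : E →ₗ[ℂ] E) ≤ Nᗮ := by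
      rintro _ ⟨x, rfl⟩
      exact N.sub_starProjection_mem_orthogonal x
    have h2 : Module.rank ℂ Nᗮ ≤ LinearMap.rank (L : E →ₗ[ℂ] E) := by
      refine LinearMap.rank_le_of_injective
        ((L : E →ₗ[ℂ] E).rangeRestrict ∘ₗ Nᗮ.subtype) ?_
      rw [← LinearMap.ker_eq_bot, LinearMap.ker_eq_bot']
      intro x hx
      have hx' : (x : E) ∈ N := congrArg Subtype.val hx
      have := Submodule.inner_right_of_mem_orthogonal hx' x.2
      exact Subtype.ext (inner_self_eq_zero.1 this)
    exact (Submodule.rank_mono h1).trans (h2.trans hL)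
  let δ' : E →L[ℂ] E := P ∘L R
  have hδ' : ‖δ'‖ ≤ Real.sqrt ε := by
    have : δ' = star δ := by
      rw [show δ = R * P from rfl, star_mul, hPs.star_eq, hR.star_eq]; rfl
    rw [this, norm_star]; exact hδ
  refine ⟨R ∘L M ∘L R - δ' ∘L M ∘L δ, ?_, fun x => ?_⟩
  -- With Z = 1 - P, the difference RMR - P(RMR)P splits into two terms containing a factor Z of
  -- rank at most n. This is the source of the factor 2.
  · have key : R ∘L M ∘L R - δ' ∘L M ∘L δ = Z ∘L (R ∘L M ∘L R) + (P ∘L R ∘L M ∘L R) ∘L Z := by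
      ext x
      simp [δ', δ, Z]
    rw [key]
    refine (LinearMap.rank_add_le _ _).trans ?_
    rw [two_mul, Nat.cast_add]
    gcongr
    · exact (LinearMap.rank_comp_le_left ((R ∘L M ∘L R : E →L[ℂ] E) : E →ₗ[ℂ] E)
        (Z : E →ₗ[ℂ] E)).trans hZrank
    · exact (LinearMap.rank_comp_le_right (Z : E →ₗ[ℂ] E)
        ((P ∘L R ∘L M ∘L R : E →L[ℂ] E) : E →ₗ[ℂ] E)).trans hZrank
  · simp only [sub_apply, sub_sub_cancel]
    calc ‖(δ' ∘L M ∘L δ) x‖ = ‖δ' (M (δ x))‖ := rfl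
      _ ≤ ‖δ'‖ * (‖M‖ * (‖δ‖ * ‖x‖)) := by
        refine (δ'.le_opNorm _).trans ?_
        gcongr
        refine (M.le_opNorm _).trans ?_
        gcongr
        exact δ.le_opNorm _
      _ ≤ Real.sqrt ε * (‖M‖ * (Real.sqrt ε * ‖x‖)) := by gcongr
      _ = ‖M‖ * (Real.sqrt ε * Real.sqrt ε) * ‖x‖ := by ring
      _ = _ := by rw [Real.mul_self_sqrt hε]

/-- The square root of a compact operator is compact. -/
theorem isCompactOperator_of_sq {R : E →L[ℂ] E} (hR : IsSelfAdjoint R)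
    (h : IsCompactOperator (R ∘L R : E →L[ℂ] E)) : IsCompactOperator R := by
  have h' := (isCompactOperator_iff_isCompact_closure_image_closedBall
    ((R ∘L R : E →L[ℂ] E) : E →ₗ[ℂ] E) one_pos).1 h
  refine (isCompactOperator_iff_isCompact_closure_image_closedBall (R : E →ₗ[ℂ] E) one_pos).2 ?_
  have htb : TotallyBounded ((R ∘L R : E →L[ℂ] E) '' Metric.closedBall 0 1) :=
    h'.totallyBounded.subset subset_closure
  suffices TotallyBounded (R '' Metric.closedBall 0 1) from
    this.closure.isCompact_of_isClosed isClosed_closure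
  rw [Metric.totallyBounded_iff] at htb ⊢
  intro ε hε
  -- If R²x and R²x' are both within ε²/8 of the same net point, then ‖R(x - x')‖² ≤ ‖x - x'‖ ‖R²(x
  -- - x')‖ ≤ 2 · ε²/4 < ε². Hence one preimage per net point gives an ε-net for R.
  obtain ⟨t, ht, hcov⟩ := htb (ε ^ 2 / 8) (by positivity)
  choose! c hc using fun y (hy : ∃ x ∈ Metric.closedBall (0 : E) 1, dist (R (R x)) y < ε ^ 2 / 8) => hy
  refine ⟨(fun y => R (c y)) '' t, ht.image _, ?_⟩
  rintro _ ⟨x, hx, rfl⟩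
  obtain ⟨y, hy, hxy⟩ := Set.mem_iUnion₂.1 (hcov ⟨x, hx, rfl⟩)
  obtain ⟨h1, h2⟩ := hc y ⟨x, hx, hxy⟩
  refine Set.mem_iUnion₂.2 ⟨_, ⟨y, hy, rfl⟩, ?_⟩
  rw [Metric.mem_ball, dist_eq_norm, ← map_sub]
  have hx1 : ‖x‖ ≤ 1 := by simpa using hx
  have hc1 : ‖c y‖ ≤ 1 := by simpa using h1
  have h3 : ‖R (R (x - c y))‖ < ε ^ 2 / 4 := by
    rw [map_sub, map_sub, ← dist_eq_norm]
    calc dist (R (R x)) (R (R (c y))) ≤ dist (R (R x)) y + dist (R (R (c y))) y :=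
          dist_triangle_right _ _ _
      _ < ε ^ 2 / 8 + ε ^ 2 / 8 := add_lt_add hxy h2
      _ = _ := by ring
  have h4 : ‖x - c y‖ ≤ 2 := (norm_sub_le _ _).trans (by linarith)
  have h5 : ‖R (x - c y)‖ ^ 2 < ε ^ 2 := by
    calc ‖R (x - c y)‖ ^ 2 = ‖⟪x - c y, R (R (x - c y))⟫‖ := by
          have : ⟪R (x - c y), R (x - c y)⟫ = ⟪x - c y, R (R (x - c y))⟫ := hR.isSymmetric _ _
          rw [← this, inner_self_eq_norm_sq_to_K]
          simp
      _ ≤ ‖x - c y‖ * ‖R (R (x - c y))‖ := norm_inner_le_norm _ _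
      _ ≤ 2 * (ε ^ 2 / 4) := by gcongr
      _ < ε ^ 2 := by nlinarith [sq_pos_of_pos hε]
  exact lt_of_pow_lt_pow_left₀ 2 hε.le h5

/-- Both squared norms equal (T*Tx, x). This lets |T|, which carries the eigenvalues, replace T in
norm estimates. -/
theorem norm_abs_apply (T : E →L[ℂ] E) (x : E) : ‖CFC.abs T x‖ = ‖T x‖ := by
  have hs : IsSelfAdjoint (CFC.abs T) := (CFC.abs_nonneg T).isSelfAdjoint
  have h1 : ⟪CFC.abs T x, CFC.abs T x⟫ = ⟪T x, T x⟫ := by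
    have h2 : ⟪CFC.abs T x, CFC.abs T x⟫ = ⟪x, CFC.abs T (CFC.abs T x)⟫ := hs.isSymmetric _ _
    have h3 : CFC.abs T (CFC.abs T x) = ContinuousLinearMap.adjoint T (T x) :=
      DFunLike.congr_fun (CFC.abs_mul_abs T) x
    rw [h2, h3, ContinuousLinearMap.adjoint_inner_right]
  rw [inner_self_eq_norm_sq_to_K, inner_self_eq_norm_sq_to_K] at h1
  have h2 : ‖CFC.abs T x‖ ^ 2 = ‖T x‖ ^ 2 := by exact_mod_cast h1
  exact (sq_eq_sq₀ (norm_nonneg _) (norm_nonneg _)).1 h2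

theorem isCompactOperator_abs {T : E →L[ℂ] E} (h : IsCompactOperator T) :
    IsCompactOperator (CFC.abs T : E →L[ℂ] E) := by
  apply isCompactOperator_of_sq (CFC.abs_nonneg T).isSelfAdjoint
  have h1 : (CFC.abs T ∘L CFC.abs T : E →L[ℂ] E) = ContinuousLinearMap.adjoint T ∘L T :=
    CFC.abs_mul_abs T
  rw [h1]
  exact h.clm_comp (ContinuousLinearMap.adjoint T)

end Approximation

/-! ### Multiplicities of singular values -/

section Counting

open Module.End MeasureTheory ComplexOrder

/-- The layer cake formula for weighted sums of powers. -/
theorem tsum_mul_rpow_eq_lintegral {ι : Type*} (m : ι → ℝ≥0∞) (f : ι → ℝ) (hf : ∀ i, 0 ≤ f i)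
    {p : ℝ} (hp : 0 < p) :
    ∑' i, m i * ENNReal.ofReal (f i ^ p) =
      ENNReal.ofReal p * ∫⁻ t in Set.Ioi (0 : ℝ),
        (∑' i, Set.indicator {i | t < f i} m i) * ENNReal.ofReal (t ^ (p - 1)) := by
  -- The weights become a sum of point masses with every set measurable, so the measure-theoretic
  -- layer cake formula applies.
  let _ : MeasurableSpace ι := ⊤
  let μ : Measure ι := Measure.sum fun i => m i • Measure.dirac i
  have hμ : ∀ s : Set ι, μ s = ∑' i, Set.indicator s m i := by
    intro s
    rw [Measure.sum_apply _ (by trivial)]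
    refine tsum_congr fun i => ?_
    rw [Measure.smul_apply, Measure.dirac_apply' _ (by trivial)]
    by_cases h : i ∈ s <;> simp [h]
  have := lintegral_rpow_eq_lintegral_meas_lt_mul μ (f := f) (Filter.Eventually.of_forall hf)
    (measurable_from_top.aemeasurable) hp
  simp only [hμ] at this
  rw [← this, lintegral_sum_measure]
  refine tsum_congr fun i => ?_
  rw [lintegral_smul_measure, lintegral_dirac' _ measurable_from_top, smul_eq_mul]

variable {E : Type u} [NormedAddCommGroup E] [InnerProductSpace ℂ E] [CompleteSpace E]

/-- The multiplicity of `s` as a singular value of `T`. -/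
def singularMultiplicity (T : E →L[ℂ] E) (s : {s : ℝ // 0 < s}) : ℕ :=
  Module.finrank ℂ (eigenspace ((CFC.abs T : E →L[ℂ] E) : Module.End ℂ E) ((s : ℝ) : ℂ))

theorem isSymmetric_abs (T : E →L[ℂ] E) :
    ((CFC.abs T : E →L[ℂ] E) : E →ₗ[ℂ] E).IsSymmetric :=
  (CFC.abs_nonneg T).isSelfAdjoint.isSymmetric

theorem finiteDimensional_eigenspace_abs {T : E →L[ℂ] E} (hT : IsCompactOperator T)
    (s : {s : ℝ // 0 < s}) : FiniteDimensional ℂ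
      (eigenspace ((CFC.abs T : E →L[ℂ] E) : Module.End ℂ E) ((s : ℝ) : ℂ)) :=
  ContinuousLinearMap.finite_dimensional_eigenspace (isCompactOperator_abs hT) _
    (by exact_mod_cast s.2.ne')

theorem orthogonalFamily_eigenspace_abs (T : E →L[ℂ] E) : OrthogonalFamily ℂ
    (fun s : {s : ℝ // 0 < s} =>
      eigenspace ((CFC.abs T : E →L[ℂ] E) : Module.End ℂ E) ((s : ℝ) : ℂ))
    fun s => (eigenspace ((CFC.abs T : E →L[ℂ] E) : Module.End ℂ E) ((s : ℝ) : ℂ)).subtypeₗᵢ :=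
  (isSymmetric_abs T).orthogonalFamily_eigenspaces.comp
    (γ := {s : ℝ // 0 < s}) (f := fun s => ((s : ℝ) : ℂ))
    (fun _ _ h => Subtype.ext (Complex.ofReal_injective h))

/-- On the orthogonal sum of eigenspaces of |T| with eigenvalues above ε one has ‖Tx‖ > ε‖x‖ for x ≠
0, so the approximating operator is injective there and its rank bounds the dimension. -/
theorem IsApproxByRank.sum_singularMultiplicity_le {T : E →L[ℂ] E} (hT : IsCompactOperator T)
    {n : ℕ} {ε : ℝ} (hε : 0 ≤ ε) (h : IsApproxByRank n ε T) (S : Finset {s : ℝ // 0 < s})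
    (hS : ∀ s ∈ S, ε < s) : ∑ s ∈ S, singularMultiplicity T s ≤ n := by
  obtain ⟨L, hL, h⟩ := h
  let V : {s : ℝ // 0 < s} → Submodule ℂ E :=
    fun s => eigenspace ((CFC.abs T : E →L[ℂ] E) : Module.End ℂ E) ((s : ℝ) : ℂ)
  have hV := orthogonalFamily_eigenspace_abs T
  have hfin : ∀ s, FiniteDimensional ℂ (V s) := finiteDimensional_eigenspace_abs hT
  let Φ : (∀ s : S, V s) →ₗ[ℂ] E := ∑ s : S, (V s).subtype ∘ₗ LinearMap.proj s
  have hΦ : ∀ v, Φ v = ∑ s : S, (v s : E) := fun v => by simp [Φ]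
  have hV' := hV.comp (Subtype.val_injective (p := fun s => s ∈ S))
  have hinj : Function.Injective ((L : E →ₗ[ℂ] E).rangeRestrict ∘ₗ Φ) := by
    rw [← LinearMap.ker_eq_bot, LinearMap.ker_eq_bot']
    intro v hv
    have hv' : L (Φ v) = 0 := congrArg Subtype.val hv
    have h1 : ‖T (Φ v)‖ ≤ ε * ‖Φ v‖ := by simpa [hv'] using h (Φ v)
    have h2 : ‖Φ v‖ ^ 2 = ∑ s : S, ‖v s‖ ^ 2 := by
      rw [hΦ]; exact hV'.norm_sum v Finset.univ
    have h3 : ‖T (Φ v)‖ ^ 2 = ∑ s : S, (s : ℝ) ^ 2 * ‖v s‖ ^ 2 := by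
      rw [← norm_abs_apply, hΦ, map_sum]
      have : ∀ s : S, (CFC.abs T : E →L[ℂ] E) (v s : E) =
          (((((s : {s : ℝ // 0 < s}) : ℝ) : ℂ) • v s : V s) : E) :=
        fun s => mem_eigenspace_iff.1 (v s).2
      simp only [this]
      rw [show ‖∑ s : S, (((((s : {s : ℝ // 0 < s}) : ℝ) : ℂ) • v s : V s) : E)‖ ^ 2 = _ from
        hV'.norm_sum (fun s => ((((s : {s : ℝ // 0 < s}) : ℝ) : ℂ) • v s : V s)) Finset.univ]
      refine Finset.sum_congr rfl fun s _ => ?_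
      rw [norm_smul, mul_pow]
      simp
    have h4 : ∑ s : S, ((s : ℝ) ^ 2 - ε ^ 2) * ‖v s‖ ^ 2 ≤ 0 := by
      have : ‖T (Φ v)‖ ^ 2 ≤ ε ^ 2 * ‖Φ v‖ ^ 2 := by rw [← mul_pow]; gcongr
      rw [h2, h3, Finset.mul_sum] at this
      simpa [sub_mul] using this
    have hpos : ∀ s : S, 0 < (s : ℝ) ^ 2 - ε ^ 2 := fun s => by
      have := hS s s.2
      nlinarith
    have h5 := (Finset.sum_eq_zero_iff_of_nonneg
      (fun s _ => mul_nonneg (hpos s).le (sq_nonneg ‖v s‖))).1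
      (le_antisymm h4 (Finset.sum_nonneg fun s _ => mul_nonneg (hpos s).le (sq_nonneg _)))
    funext s
    have := h5 s (Finset.mem_univ _)
    rw [mul_eq_zero, or_iff_right (hpos s).ne'] at this
    simpa using this
  have h6 := LinearMap.rank_le_of_injective _ hinj
  have h7 : (Module.finrank ℂ (∀ s : S, V s) : Cardinal) ≤ n := by
    rw [Module.finrank_eq_rank]; exact h6.trans hL
  rw [Module.finrank_pi_fintype, Finset.sum_coe_sort S (fun s => Module.finrank ℂ (V s))] at h7
  exact_mod_cast h7

/-- Outside the eigenspaces of `|T|` for the eigenvalues in `S`, `T` is as small as the remaining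
eigenvalues permit. -/
theorem isApproxByRank_sum_singularMultiplicity {T : E →L[ℂ] E} (hT : IsCompactOperator T)
    {t : ℝ} (ht : 0 < t) (S : Finset {s : ℝ // 0 < s})
    (hS : ∀ s : {s : ℝ // 0 < s}, t < s → singularMultiplicity T s ≠ 0 → s ∈ S) :
    IsApproxByRank (∑ s ∈ S, singularMultiplicity T s) t T := by
  let V : {s : ℝ // 0 < s} → Submodule ℂ E :=
    fun s => eigenspace ((CFC.abs T : E →L[ℂ] E) : Module.End ℂ E) ((s : ℝ) : ℂ)
  have hV := orthogonalFamily_eigenspace_abs T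
  have hfin : ∀ s, FiniteDimensional ℂ (V s) := finiteDimensional_eigenspace_abs hT
  let P : E →L[ℂ] E := ∑ s ∈ S, (V s).starProjection
  -- X is |T| with the selected eigenspaces cut out; its norm is the approximation error.
  let X : E →L[ℂ] E := CFC.abs T - ∑ s ∈ S, ((s : ℝ) : ℂ) • (V s).starProjection
  have hXP : ∀ x, X x = CFC.abs T (x - P x) := by
    intro x
    simp only [X, P, sub_apply, map_sub, sum_apply, map_sum]
    congr 1
    refine Finset.sum_congr rfl fun s _ => ?_
    exact (mem_eigenspace_iff.1 ((V s).starProjection_apply_mem x)).symm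
  have hXc : IsCompactOperator X := by
    have : X = CFC.abs T ∘L (1 - P) := ContinuousLinearMap.ext hXP
    rw [this]
    exact (isCompactOperator_abs hT).comp_clm (1 - P)
  have hXs : X.IsSymmetric := by
    refine IsSelfAdjoint.isSymmetric ((CFC.abs_nonneg T).isSelfAdjoint.sub
      (isSelfAdjoint_sum _ fun s _ => ?_))
    exact IsSelfAdjoint.smul (by simp [IsSelfAdjoint]) (isSelfAdjoint_starProjection _)
  have hPV : ∀ s ∈ S, ∀ y ∈ V s, ∀ x, ⟪y, X x⟫ = 0 := by
    intro s hs y hy x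
    have h1 : ⟪y, CFC.abs T (x - P x)⟫ = ⟪CFC.abs T y, x - P x⟫ :=
      (isSymmetric_abs T _ _).symm
    have h2 : CFC.abs T y = ((s : ℝ) : ℂ) • y := mem_eigenspace_iff.1 hy
    have h3 : ⟪y, P x⟫ = ⟪y, x⟫ := by
      simp only [P, sum_apply, inner_sum]
      rw [Finset.sum_eq_single_of_mem s hs]
      · rw [← Submodule.inner_starProjection_left_eq_right,
          Submodule.starProjection_eq_self_iff.2 hy]
      · intro r _ hrs
        exact hV hrs.symm ⟨y, hy⟩ ⟨_, (V r).starProjection_apply_mem x⟩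
    rw [hXP, h1, h2, inner_smul_left, inner_sub_right, h3, sub_self, mul_zero]
  -- A compact self-adjoint X ≠ 0 has an eigenvalue of modulus ‖X‖. Its eigenvectors are orthogonal
  -- to the removed eigenspaces, hence are eigenvectors of |T| with the same nonnegative eigenvalue.
  -- Were this above t, its eigenspace would have been removed.
  have hXt : ‖X‖ ≤ t := by
    by_contra! hlt
    have hX0 : X ≠ 0 := by
      rintro h0
      rw [h0, norm_zero] at hlt
      exact hlt.not_ge ht.le
    have : Nontrivial E := by
      by_contra hE
      rw [not_nontrivial_iff_subsingleton] at hE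
      exact hX0 (Subsingleton.elim _ _)
    obtain ⟨μ, hμ, hμX⟩ := spectrum.exists_nnnorm_eq_spectralRadius X
    rw [X.spectralRadius_eq_nnnorm hXs.isSelfAdjoint] at hμX
    have hμX' : ‖μ‖ = ‖X‖ := congrArg NNReal.toReal (ENNReal.coe_injective hμX)
    have hμ0 : μ ≠ 0 := by
      rw [← norm_pos_iff, hμX']; exact norm_pos_iff.2 hX0
    obtain ⟨x, hx⟩ := ((hXc.hasEigenvalue_iff_mem_spectrum hμ0).2 hμ).exists_hasEigenvector
    have hXx : X x = μ • x := hx.apply_eq_smul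
    have horth : ∀ s ∈ S, ∀ y ∈ V s, ⟪y, x⟫ = 0 := by
      intro s hs y hy
      have := hPV s hs y hy x
      rw [hXx, inner_smul_right] at this
      exact (mul_eq_zero.1 this).resolve_left hμ0
    have hPx : P x = 0 := by
      simp only [P, sum_apply]
      exact Finset.sum_eq_zero fun s hs => (Submodule.starProjection_apply_eq_zero_iff _).2
        ((Submodule.mem_orthogonal _ _).2 (horth s hs))
    have habs : CFC.abs T x = μ • x := by rw [← hXx, hXP, hPx, sub_zero]
    have hnn : 0 ≤ μ := by
      have h1 := ((ContinuousLinearMap.nonneg_iff_isPositive _).1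
        (CFC.abs_nonneg T)).inner_nonneg_right x
      rw [habs, inner_smul_right, inner_self_eq_norm_sq_to_K] at h1
      have h2 : (0 : ℂ) < (‖x‖ : ℂ) ^ 2 := by
        have := norm_pos_iff.2 hx.2
        exact_mod_cast pow_pos this 2
      simpa [mul_assoc, h2.ne'] using mul_nonneg h1 (inv_nonneg.2 h2.le)
    have hμs : ((‖μ‖ : ℝ) : ℂ) = μ := Complex.eq_coe_norm_of_nonneg hnn |>.symm
    let s : {s : ℝ // 0 < s} := ⟨‖μ‖, norm_pos_iff.2 hμ0⟩
    have hxs : x ∈ V s := mem_eigenspace_iff.2 (habs.trans (by rw [← hμs]))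
    have hsS : s ∈ S := by
      refine hS s (hlt.trans_eq hμX'.symm) fun h0 => hx.2 ?_
      have := Submodule.finrank_eq_zero.1 h0
      exact (Submodule.mem_bot ℂ).1 (this.le hxs)
    exact hx.2 (inner_self_eq_zero.1 (horth s hsS x hxs))
  refine ⟨T ∘L P, ?_, fun x => ?_⟩
  · refine (LinearMap.rank_comp_le_right (P : E →ₗ[ℂ] E) (T : E →ₗ[ℂ] E)).trans ?_
    rw [show (P : E →ₗ[ℂ] E) = ∑ s ∈ S, ((V s).starProjection : E →ₗ[ℂ] E) from
      ContinuousLinearMap.toLinearMap_sum _ _, Nat.cast_sum]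
    refine (LinearMap.rank_finsetSum_le _ _).trans (Finset.sum_le_sum fun s _ => ?_)
    rw [LinearMap.rank, Submodule.range_starProjection]
    exact (Module.finrank_eq_rank ℂ (V s)).ge
  · rw [ContinuousLinearMap.comp_apply, ← map_sub, ← norm_abs_apply, ← hXP]
    exact (X.le_opNorm x).trans (by gcongr)

/-- Comparison of Schatten classes through approximation by operators of finite rank. -/
theorem MemSchatten.of_isApproxByRank {F : Type u} [NormedAddCommGroup F] [InnerProductSpace ℂ F]
    [CompleteSpace F] {p : ℝ≥0∞} (hp : 0 < p) {T : E →L[ℂ] E} {K : F →L[ℂ] F}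
    (hT : MemSchatten p T) (hK : IsCompactOperator K) {k : ℕ} (hk : k ≠ 0) {c : ℝ} (hc : 0 < c)
    (h : ∀ (n : ℕ) (t : ℝ), 0 < t → IsApproxByRank n t T → IsApproxByRank (k * n) (c * t) K) :
    MemSchatten p K := by
  refine ⟨hK, fun hp' => ?_⟩
  have hq : 0 < p.toReal := ENNReal.toReal_pos hp.ne' hp'
  set q := p.toReal
  let N : ℝ → ℝ≥0∞ := fun t => ∑' s : {s : ℝ // 0 < s},
    Set.indicator {s : {s : ℝ // 0 < s} | t < s} (fun s => (singularMultiplicity T s : ℝ≥0∞)) s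
  -- Counting inequality: K has at most k times as many singular values above ct as T has above t,
  -- with multiplicity. Scaling by c⁻¹ puts both counts at the same t for the layer cake integral.
  have hle : ∀ t : ℝ, 0 < t → ∑' s : {s : ℝ // 0 < s},
      Set.indicator {s : {s : ℝ // 0 < s} | t < c⁻¹ * s}
        (fun s => (singularMultiplicity K s : ℝ≥0∞)) s ≤ k * N t := by
    intro t ht
    by_cases hN : N t = ∞
    · rw [hN, ENNReal.mul_top (by exact_mod_cast hk)]
      exact le_top
    have hfin : {s : {s : ℝ // 0 < s} | t < s ∧ singularMultiplicity T s ≠ 0}.Finite := by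
      refine (ENNReal.finite_const_le_of_tsum_ne_top hN one_ne_zero).subset ?_
      rintro s ⟨hs, hs'⟩
      rw [Set.mem_ofPred_eq, Set.indicator_of_mem (show s ∈ {s : {s : ℝ // 0 < s} | t < s} from hs)]
      exact_mod_cast Nat.one_le_iff_ne_zero.2 hs'
    let S := hfin.toFinset
    have hNt : N t = (∑ s ∈ S, singularMultiplicity T s : ℕ) := by
      rw [Nat.cast_sum]
      refine (tsum_eq_sum fun s hs => ?_).trans (Finset.sum_congr rfl fun s hs => ?_)
      · by_cases hst : t < s
        · have : singularMultiplicity T s = 0 := by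
            by_contra h0; exact hs (hfin.mem_toFinset.2 ⟨hst, h0⟩)
          simp [this]
        · exact Set.indicator_of_notMem (s := {s : {s : ℝ // 0 < s} | t < s}) hst _
      · exact Set.indicator_of_mem (show s ∈ {s : {s : ℝ // 0 < s} | t < s} from
          (hfin.mem_toFinset.1 hs).1) _
    have happ := h _ t ht (isApproxByRank_sum_singularMultiplicity hT.1 ht S
      fun s hs hs' => hfin.mem_toFinset.2 ⟨hs, hs'⟩)
    rw [hNt, ← Nat.cast_mul, ENNReal.tsum_eq_iSup_sum]
    refine iSup_le fun A => ?_
    classical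
    rw [Finset.sum_indicator_eq_sum_filter, ← Nat.cast_sum, Nat.cast_le]
    refine happ.sum_singularMultiplicity_le hK (by positivity) _ fun s hs => ?_
    have := (Finset.mem_filter.1 hs).2
    rwa [Set.mem_ofPred_eq, lt_inv_mul_iff₀ hc] at this
  have h1 := tsum_mul_rpow_eq_lintegral (fun s : {s : ℝ // 0 < s} =>
    (singularMultiplicity T s : ℝ≥0∞)) (fun s => (s : ℝ)) (fun s => s.2.le) hq
  have h2 := tsum_mul_rpow_eq_lintegral (fun s : {s : ℝ // 0 < s} =>
    (singularMultiplicity K s : ℝ≥0∞)) (fun s => c⁻¹ * (s : ℝ))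
    (fun s => mul_nonneg (inv_nonneg.2 hc.le) s.2.le) hq
  have hfin : ∑' s : {s : ℝ // 0 < s},
      (singularMultiplicity T s : ℝ≥0∞) * ENNReal.ofReal ((s : ℝ) ^ q) ≠ ∞ := by
    refine ne_of_eq_of_ne (tsum_congr fun s => ?_) (hT.2 hp').tsum_ofReal_ne_top
    rw [ENNReal.ofReal_mul (Nat.cast_nonneg _), ENNReal.ofReal_natCast]
    rfl
  have h3 : ∑' s : {s : ℝ // 0 < s},
      (singularMultiplicity K s : ℝ≥0∞) * ENNReal.ofReal ((c⁻¹ * s : ℝ) ^ q) ≤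
        k * ∑' s : {s : ℝ // 0 < s},
      (singularMultiplicity T s : ℝ≥0∞) * ENNReal.ofReal ((s : ℝ) ^ q) := by
    rw [h1, h2, mul_left_comm, ← lintegral_const_mul' _ _ (ENNReal.natCast_ne_top k)]
    gcongr ENNReal.ofReal q * ?_
    refine setLIntegral_mono' measurableSet_Ioi fun t ht => ?_
    rw [← mul_assoc]
    gcongr
    exact hle t ht
  have h4 := ENNReal.summable_toReal
    (h3.trans_lt (ENNReal.mul_lt_top (ENNReal.natCast_lt_top k) hfin.lt_top)).ne
  refine (h4.mul_left (c ^ q)).congr fun s => ?_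
  have hs := s.2
  rw [ENNReal.toReal_mul, ENNReal.toReal_natCast, ENNReal.toReal_ofReal (by positivity),
    Real.mul_rpow (by positivity) hs.le, Real.inv_rpow hc.le]
  have := (Real.rpow_pos_of_pos hc q).ne'
  field_simp
  rfl

end Counting

/-! ### Graphs and resolvents of self-adjoint operators -/

section SelfAdjoint

open LinearPMap
open scoped ComplexConjugate

theorem mem_graph_subScalar {E : Type u} [NormedAddCommGroup E] [InnerProductSpace ℂ E]
    {A : E →ₗ.[ℂ] E} {z : ℂ} {f g : E} :
    (f, g) ∈ (subScalar A z).graph ↔ (f, g + z • f) ∈ A.graph := by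
  have h : ∀ x : A.domain, (subScalar A z) x = -(z • (x : E)) + A x := fun x => rfl
  rw [mem_graph_iff, mem_graph_iff]
  constructor
  · rintro ⟨x, rfl, hx⟩
    exact ⟨x, rfl, (neg_add_eq_iff_eq_add.1 ((h x).symm.trans hx)).trans (add_comm _ _)⟩
  · rintro ⟨x, rfl, hx⟩
    exact ⟨x, rfl, (h x).trans (neg_add_eq_iff_eq_add.2 (hx.trans (add_comm _ _)))⟩

variable {E : Type u} [NormedAddCommGroup E] [InnerProductSpace ℂ E] [CompleteSpace E]
variable {A B : E →ₗ.[ℂ] E}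

/-- The graph equals its own adjoint relation. In this form self-adjointness both supplies symmetry
and certifies membership in the graph, without handling domains. -/
theorem mem_graph_iff_of_isSelfAdjoint (hA : IsSelfAdjoint A) {f f' : E} :
    (f, f') ∈ A.graph ↔ ∀ g g' : E, (g, g') ∈ A.graph → ⟪g', f⟫ = ⟪g, f'⟫ := by
  have h : A.graph = A.graph.adjoint := by
    conv_lhs => rw [← isSelfAdjoint_def.1 hA]
    exact adjoint_graph_eq_graph_adjoint hA.dense_domain
  conv_lhs => rw [h]
  simp only [Submodule.mem_adjoint_iff, sub_eq_zero]

/-- (Af, f) is real, so the imaginary part of ((A - z)f, f) is -Im z ‖f‖²; then Cauchy–Schwarz. -/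
theorem abs_im_mul_norm_le (hA : IsSelfAdjoint A) (z : ℂ) {f f' : E} (hf : (f, f') ∈ A.graph) :
    |z.im| * ‖f‖ ≤ ‖f' - z • f‖ := by
  have hsym : ⟪f', f⟫ = ⟪f, f'⟫ := (mem_graph_iff_of_isSelfAdjoint hA).1 hf _ _ hf
  have hre : (⟪f, f'⟫).im = 0 := by
    rw [← Complex.conj_eq_iff_im, inner_conj_symm, hsym]
  have h1 : (⟪f, f' - z • f⟫).im = -(z.im * ‖f‖ ^ 2) := by
    rw [inner_sub_right, inner_smul_right, inner_self_eq_norm_sq_to_K, Complex.sub_im, hre]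
    simp [← Complex.ofReal_pow]
  have h2 : |z.im| * ‖f‖ ^ 2 ≤ ‖f‖ * ‖f' - z • f‖ := by
    calc |z.im| * ‖f‖ ^ 2 = |(⟪f, f' - z • f⟫).im| := by
          rw [h1, abs_neg, abs_mul, abs_of_nonneg (sq_nonneg ‖f‖)]
      _ ≤ ‖⟪f, f' - z • f⟫‖ := Complex.abs_im_le_norm _
      _ ≤ _ := norm_inner_le_norm _ _
  rcases (norm_nonneg f).eq_or_lt with h0 | h0
  · rw [← h0, mul_zero]; exact norm_nonneg _
  · refine le_of_mul_le_mul_left ?_ h0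
    calc ‖f‖ * (|z.im| * ‖f‖) = |z.im| * ‖f‖ ^ 2 := by ring
      _ ≤ _ := h2

theorem eq_zero_of_smul_mem_graph (hA : IsSelfAdjoint A) {z : ℂ} (hz : z.im ≠ 0) {f : E}
    (hf : (f, z • f) ∈ A.graph) : f = 0 := by
  have := abs_im_mul_norm_le hA z hf
  rw [sub_self, norm_zero] at this
  have h := abs_pos.2 hz
  exact norm_le_zero_iff.1 (nonpos_of_mul_nonpos_right this h)

/-- Viewed on the complete space graph A, the map A - z is bounded below, so its range is closed. A
vector orthogonal to the range satisfies Ax = z̄x and vanishes. -/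
theorem exists_resolvent (hA : IsSelfAdjoint A) {z : ℂ} (hz : z.im ≠ 0) :
    ∃ R : E →L[ℂ] E, ∀ h, (R h, h + z • R h) ∈ A.graph := by
  have hcl : IsClosed (A.graph : Set (E × E)) := hA.isClosed
  have : CompleteSpace A.graph := hcl.completeSpace_coe
  let Φ : A.graph →L[ℂ] E :=
    (ContinuousLinearMap.snd ℂ E E - z • ContinuousLinearMap.fst ℂ E E) ∘L A.graph.subtypeL
  have hΦ : ∀ x : A.graph, Φ x = (x : E × E).2 - z • (x : E × E).1 := fun x => rfl
  have hy := abs_pos.2 hz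
  have hanti : ∃ K, AntilipschitzWith K Φ := by
    refine ⟨Real.toNNReal (1 + (1 + ‖z‖) / |z.im|), Φ.antilipschitz_of_bound fun x => ?_⟩
    have h1 := abs_im_mul_norm_le hA z (f := (x : E × E).1) (f' := (x : E × E).2) x.2
    rw [← hΦ] at h1
    have h2 : ‖(x : E × E).1‖ ≤ ‖Φ x‖ / |z.im| := by rw [le_div_iff₀ hy, mul_comm]; exact h1
    have h3 : ‖(x : E × E).2‖ ≤ ‖Φ x‖ + ‖z‖ * (‖Φ x‖ / |z.im|) := by
      calc ‖(x : E × E).2‖ = ‖Φ x + z • (x : E × E).1‖ := by rw [hΦ]; simp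
        _ ≤ ‖Φ x‖ + ‖z • (x : E × E).1‖ := norm_add_le _ _
        _ ≤ _ := by rw [norm_smul]; gcongr
    rw [Real.coe_toNNReal _ (by positivity)]
    have h4 : (1 + (1 + ‖z‖) / |z.im|) * ‖Φ x‖ =
      ‖Φ x‖ + ‖z‖ * (‖Φ x‖ / |z.im|) + ‖Φ x‖ / |z.im| := by ring
    rw [h4]
    refine max_le (h2.trans ?_) (h3.trans ?_)
    · have : 0 ≤ ‖Φ x‖ + ‖z‖ * (‖Φ x‖ / |z.im|) := by positivity
      linarith
    · have : 0 ≤ ‖Φ x‖ / |z.im| := by positivity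
      linarith
  obtain ⟨K, hK⟩ := hanti
  have hclosed : IsClosed (LinearMap.range (Φ : A.graph →ₗ[ℂ] E) : Set E) :=
    hK.isClosed_range Φ.uniformContinuous
  have hrange : LinearMap.range (Φ : A.graph →ₗ[ℂ] E) = ⊤ := by
    have : CompleteSpace (LinearMap.range (Φ : A.graph →ₗ[ℂ] E)) := hclosed.completeSpace_coe
    rw [← Submodule.orthogonal_eq_bot_iff, Submodule.eq_bot_iff]
    intro x hx
    have hx' : (x, conj z • x) ∈ A.graph := by
      rw [mem_graph_iff_of_isSelfAdjoint hA]
      intro g g' hg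
      have := (Submodule.mem_orthogonal _ _).1 hx (Φ ⟨(g, g'), hg⟩) ⟨_, rfl⟩
      rw [hΦ, inner_sub_left, inner_smul_left, sub_eq_zero] at this
      rw [this, inner_smul_right]
    exact eq_zero_of_smul_mem_graph hA (z := conj z) (by simpa using hz) hx'
  let e := ContinuousLinearEquiv.ofBijective Φ (LinearMap.ker_eq_bot.2 hK.injective) hrange
  refine ⟨ContinuousLinearMap.fst ℂ E E ∘L A.graph.subtypeL ∘L (e.symm : E →L[ℂ] A.graph),
    fun h => ?_⟩
  have h1 : Φ (e.symm h) = h := e.apply_symm_apply h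
  have h2 : h + z • ((e.symm h : A.graph) : E × E).1 = ((e.symm h : A.graph) : E × E).2 := by
    rw [hΦ] at h1
    exact (sub_eq_iff_eq_add.1 h1).symm
  change (((e.symm h : A.graph) : E × E).1, h + z • ((e.symm h : A.graph) : E × E).1) ∈ A.graph
  rw [h2]
  exact (e.symm h).2

/-- The resolvent `(A - z)⁻¹` of a self-adjoint operator, as a bounded operator. -/
def boundedResolvent (A : E →ₗ.[ℂ] E) (z : ℂ) : E →L[ℂ] E :=
  Classical.epsilon fun R => ∀ h, (R h, h + z • R h) ∈ A.graph

theorem boundedResolvent_mem_graph (hA : IsSelfAdjoint A) {z : ℂ} (hz : z.im ≠ 0) (h : E) :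
    (boundedResolvent A z h, h + z • boundedResolvent A z h) ∈ A.graph :=
  Classical.epsilon_spec (exists_resolvent hA hz) h

theorem boundedResolvent_sub_smul (hA : IsSelfAdjoint A) {z : ℂ} (hz : z.im ≠ 0) {f f' : E}
    (hf : (f, f') ∈ A.graph) : boundedResolvent A z (f' - z • f) = f := by
  have h := A.graph.sub_mem (boundedResolvent_mem_graph hA hz (f' - z • f)) hf
  rw [← sub_eq_zero]
  refine eq_zero_of_smul_mem_graph hA hz ?_
  convert h using 1
  ext <;> simp
  module

theorem resolventOp_eq (hA : IsSelfAdjoint A) {z : ℂ} (hz : z.im ≠ 0) :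
    IsBoundedOp (resolventOp A z) (boundedResolvent A z) := by
  have hker : LinearMap.ker (subScalar A z).toFun = ⊥ := by
    rw [LinearMap.ker_eq_bot']
    intro f hf
    have hf' : -(z • (f : E)) + A f = 0 := hf
    refine Subtype.ext (eq_zero_of_smul_mem_graph hA hz ?_)
    rw [show z • (f : E) = A f by rw [neg_add_eq_zero] at hf'; exact hf']
    exact A.mem_graph f
  refine eq_of_eq_graph ?_
  rw [resolventOp, inverse_graph hker]
  ext ⟨x, y⟩
  have h1 : (x, y) ∈ (subScalar A z).graph.map (LinearEquiv.prodComm ℂ E E : E × E →ₗ[ℂ] E × E) ↔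
      (y, x) ∈ (subScalar A z).graph := by
    constructor
    · rintro ⟨⟨a, b⟩, h, h'⟩
      obtain ⟨rfl, rfl⟩ := Prod.mk.inj h'
      exact h
    · exact fun h => ⟨(y, x), h, rfl⟩
  rw [h1, mem_graph_subScalar]
  constructor
  · intro h
    have := boundedResolvent_sub_smul hA hz h
    rw [add_sub_cancel_right] at this
    exact (mem_graph_iff _).2 ⟨⟨x, trivial⟩, rfl, this⟩
  · intro h
    obtain ⟨⟨x', _⟩, rfl, h'⟩ := (mem_graph_iff _).1 h
    rw [← show boundedResolvent A z x' = y from h']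
    exact boundedResolvent_mem_graph hA hz x'

/-- The resolvent identity solved for the resolvent at w: the dependence on w passes only through
inversion in a Banach algebra, which gives holomorphy. -/
theorem boundedResolvent_eq_mul_inverse (hA : IsSelfAdjoint A) {z w : ℂ} (hz : z.im ≠ 0)
    (hw : w.im ≠ 0) : boundedResolvent A w =
      boundedResolvent A z * Ring.inverse (1 - (w - z) • boundedResolvent A z) := by
  have key : ∀ {z w : ℂ}, z.im ≠ 0 → w.im ≠ 0 → ∀ h, boundedResolvent A z h =
      boundedResolvent A w (h - (w - z) • boundedResolvent A z h) := by
    intro z w hz hw h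
    have := boundedResolvent_sub_smul hA hw (boundedResolvent_mem_graph hA hz h)
    refine this.symm.trans (congrArg _ ?_)
    module
  have h1 : boundedResolvent A z * (1 + (w - z) • boundedResolvent A w) =
      boundedResolvent A w := by
    ext h
    rw [mul_apply_eq_comp, key hw hz h]
    congr 1
    simp only [_root_.add_apply, one_apply_eq_self, _root_.smul_apply]
    module
  have h2 : boundedResolvent A w * (1 - (w - z) • boundedResolvent A z) =
      boundedResolvent A z := by
    ext h
    exact (key hz hw h).symm
  -- The explicit inverse 1 + (w - z)(A - w)⁻¹ exists for every nonreal w, so no Neumann series or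
  -- closeness to z is needed.
  let U : (E →L[ℂ] E)ˣ := ⟨1 - (w - z) • boundedResolvent A z,
    1 + (w - z) • boundedResolvent A w,
    by rw [sub_mul, one_mul, smul_mul_assoc, h1]; abel,
    by rw [add_mul, one_mul, smul_mul_assoc, h2]; abel⟩
  rw [show 1 - (w - z) • boundedResolvent A z = (U : E →L[ℂ] E) from rfl, Ring.inverse_unit]
  exact h1.symm

theorem differentiableAt_boundedResolvent (hA : IsSelfAdjoint A) {z : ℂ} (hz : 0 < z.im) :
    DifferentiableAt ℂ (boundedResolvent A) z := by
  have h1 : DifferentiableAt ℂ (fun w : ℂ => boundedResolvent A z *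
      Ring.inverse (1 - (w - z) • boundedResolvent A z)) z := by
    refine DifferentiableAt.const_mul ?_ _
    have h2 : DifferentiableAt ℂ (fun w : ℂ => (1 : E →L[ℂ] E) - (w - z) • boundedResolvent A z) z := by
      fun_prop
    refine DifferentiableAt.comp (𝕜 := ℂ) (g := Ring.inverse) z ?_ h2
    simp only [sub_self, zero_smul, sub_zero]
    exact differentiableAt_inverse isUnit_one
  refine h1.congr_of_eventuallyEq ?_
  filter_upwards [(isOpen_lt continuous_const Complex.continuous_im).mem_nhds hz] with w hw
  exact boundedResolvent_eq_mul_inverse hA hz.ne' (ne_of_gt hw)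

end SelfAdjoint

/-! ### The adjoint of the intersection of two self-adjoint operators -/

section Closure

open LinearPMap

theorem mem_graph_inf {E : Type u} [NormedAddCommGroup E] [InnerProductSpace ℂ E]
    {A B : E →ₗ.[ℂ] E} {f f' : E} :
    (f, f') ∈ (A ⊓ B).graph ↔ (f, f') ∈ A.graph ∧ (f, f') ∈ B.graph := by
  constructor
  · exact fun h => ⟨le_graph_of_le inf_le_left h, le_graph_of_le inf_le_right h⟩
  · rintro ⟨hA, hB⟩
    obtain ⟨⟨a, ha⟩, rfl, ha'⟩ := (mem_graph_iff _).1 hA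
    obtain ⟨⟨b, hb⟩, h, hb'⟩ := (mem_graph_iff _).1 hB
    obtain rfl : b = a := h
    exact (mem_graph_iff _).2 ⟨⟨b, ha, hb, ha'.trans hb'.symm⟩, rfl, ha'⟩

variable {E : Type u} [NormedAddCommGroup E] [InnerProductSpace ℂ E] [CompleteSpace E]

/-- Up to the rotation (a, b) ↦ (b, -a), the adjoint relation is the orthogonal complement, and a
double orthogonal complement is the closure. The passage to `WithLp 2` supplies the inner product
that `E × E` with its sup norm lacks. -/
theorem adjoint_adjoint_le_topologicalClosure (G : Submodule ℂ (E × E)) :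
    G.adjoint.adjoint ≤ G.topologicalClosure := by
  intro x hx
  let G' : Submodule ℂ (WithLp 2 (E × E)) := G.comap (WithLp.linearEquiv 2 ℂ (E × E)).toLinearMap
  have h1 : WithLp.toLp 2 x ∈ G'ᗮᗮ := by
    rw [Submodule.mem_orthogonal]
    intro v hv
    have h2 : (v.snd, -v.fst) ∈ G.adjoint := by
      rw [Submodule.mem_adjoint_iff]
      intro a b hab
      have := (Submodule.mem_orthogonal _ _).1 hv (WithLp.toLp 2 (a, b)) hab
      rw [WithLp.prod_inner_apply] at this
      rw [inner_neg_right, sub_neg_eq_add, add_comm]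
      exact this
    have h3 := (Submodule.mem_adjoint_iff _ _).1 hx _ _ h2
    rw [WithLp.prod_inner_apply, ← neg_eq_zero, neg_add]
    rw [inner_neg_left] at h3
    exact h3
  rw [Submodule.orthogonal_orthogonal_eq_closure] at h1
  exact map_mem_closure (WithLp.prod_continuous_ofLp 2 E E) h1 fun y hy => hy

variable {A B : E →ₗ.[ℂ] E} (hA : IsSelfAdjoint A) (hB : IsSelfAdjoint B)
  (hS : Dense ((A ⊓ B : E →ₗ.[ℂ] E).domain : Set E))

include hS in
theorem mem_graph_adjoint_inf {u u' : E} :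
    (u, u') ∈ (A ⊓ B)†.graph ↔
      ∀ f f' : E, (f, f') ∈ A.graph → (f, f') ∈ B.graph → ⟪f', u⟫ = ⟪f, u'⟫ := by
  rw [adjoint_graph_eq_graph_adjoint hS]
  simp only [Submodule.mem_adjoint_iff, sub_eq_zero, mem_graph_inf, and_imp]

include hA hS in
theorem le_adjoint_inf_left : A ≤ (A ⊓ B)† :=
  le_of_le_graph fun ⟨_, _⟩ h => (mem_graph_adjoint_inf hS).2 fun _ _ hf _ =>
    (mem_graph_iff_of_isSelfAdjoint hA).1 h _ _ hf

include hB hS in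
theorem le_adjoint_inf_right : B ≤ (A ⊓ B)† :=
  le_of_le_graph fun ⟨_, _⟩ h => (mem_graph_adjoint_inf hS).2 fun _ _ _ hf =>
    (mem_graph_iff_of_isSelfAdjoint hB).1 h _ _ hf

include hA hB hS in
-- The adjoint of a sum of graphs is the intersection of the adjoints, here graph A ∩ graph B =
-- graph S; a second adjoint gives graph S*.
theorem topologicalClosure_sup_graph :
    (A.graph ⊔ B.graph).topologicalClosure = (A ⊓ B)†.graph := by
  refine le_antisymm (Submodule.topologicalClosure_minimal _ (sup_le
    (le_graph_of_le (le_adjoint_inf_left hA hS)) (le_graph_of_le (le_adjoint_inf_right hB hS)))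
    (adjoint_isClosed hS)) ?_
  refine le_trans ?_ (adjoint_adjoint_le_topologicalClosure _)
  rintro ⟨u, u'⟩ hu
  rw [Submodule.mem_adjoint_iff]
  intro f f' hf
  rw [Submodule.mem_adjoint_iff] at hf
  simp only [sub_eq_zero] at hf ⊢
  exact (mem_graph_adjoint_inf hS).1 hu _ _
    ((mem_graph_iff_of_isSelfAdjoint hA).2 fun g g' hg => hf g g' (Submodule.mem_sup_left hg))
    ((mem_graph_iff_of_isSelfAdjoint hB).2 fun g g' hg => hf g g' (Submodule.mem_sup_right hg))

include hA hB hS in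
theorem isGraphDense_sup_domain : IsGraphDense (A ⊓ B)† (A.domain ⊔ B.domain) := by
  have hAS := le_adjoint_inf_left (B := B) hA hS
  have hBS := le_adjoint_inf_right (A := A) hB hS
  refine ⟨sup_le hAS.1 hBS.1, fun f ε hε => ?_⟩
  have hf : ((f : E), (A ⊓ B)† f) ∈ (A.graph ⊔ B.graph).topologicalClosure := by
    rw [topologicalClosure_sup_graph hA hB hS]; exact mem_graph _ f
  obtain ⟨⟨g, g'⟩, hg, hd⟩ := Metric.mem_closure_iff.1 hf (ε / 2) (half_pos hε)
  have hgS : (g, g') ∈ (A ⊓ B)†.graph :=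
    sup_le (le_graph_of_le hAS) (le_graph_of_le hBS) hg
  obtain ⟨g0, rfl, hg0⟩ := (mem_graph_iff _).1 hgS
  refine ⟨g0, ?_, ?_⟩
  · obtain ⟨⟨a, a'⟩, ha, ⟨b, b'⟩, hb, hab⟩ := Submodule.mem_sup.1 hg
    exact Submodule.mem_sup.2 ⟨a, mem_domain_of_mem_graph ha, b, mem_domain_of_mem_graph hb,
      congrArg Prod.fst hab⟩
  · rw [Prod.dist_eq, max_lt_iff] at hd
    have h1 : ‖((f - g0 : (A ⊓ B)†.domain) : E)‖ < ε / 2 := by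
      have := hd.1
      rwa [dist_eq_norm] at this
    have h2 : ‖(A ⊓ B)† (f - g0)‖ < ε / 2 := by
      have := hd.2
      rw [dist_eq_norm] at this
      rw [LinearPMap.map_sub]
      have hg0' : (A ⊓ B)† g0 = g' := hg0
      rw [hg0']
      exact this
    rw [graphNorm, Real.sqrt_lt' hε]
    have h3 := pow_lt_pow_left₀ h1 (norm_nonneg _) two_ne_zero
    have h4 := pow_lt_pow_left₀ h2 (norm_nonneg _) two_ne_zero
    have : 0 < ε ^ 2 := by positivity
    linarith [show (ε / 2) ^ 2 = ε ^ 2 / 4 by ring]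

end Closure

/-! ### The coupling operator -/

section CouplingOperator

open LinearPMap
open scoped ComplexConjugate

/-- `ker (T - z)`, as a subspace of the whole space. -/
def defectSubspace {E : Type u} [NormedAddCommGroup E] [InnerProductSpace ℂ E]
    (T : E →ₗ.[ℂ] E) (z : ℂ) : Submodule ℂ E :=
  T.graph.comap (LinearMap.id.prod (z • LinearMap.id))

theorem mem_defectSubspace {E : Type u} [NormedAddCommGroup E] [InnerProductSpace ℂ E]
    {T : E →ₗ.[ℂ] E} {z : ℂ} {u : E} :
    u ∈ defectSubspace T z ↔ (u, z • u) ∈ T.graph := Iff.rfl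

variable {E : Type u} [NormedAddCommGroup E] [InnerProductSpace ℂ E] [CompleteSpace E]

variable {A B : E →ₗ.[ℂ] E}

theorem isClosed_defectSubspace (hS : Dense ((A ⊓ B : E →ₗ.[ℂ] E).domain : Set E)) (z : ℂ) :
    IsClosed (defectSubspace (A ⊓ B)† z : Set E) :=
  (adjoint_isClosed hS).preimage (f := fun u : E => (u, z • u)) (by fun_prop)

/-- The form of Green's identity for `f = a + u`, `g = b + v` with `a, b ∈ dom A`, where the
operator acts on `u` and `v` as multiplication by `z`. -/
theorem green_identity (hA : IsSelfAdjoint A) (z : ℂ) {a a' b b' : E} (ha : (a, a') ∈ A.graph)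
    (hb : (b, b') ∈ A.graph) (u v : E) :
    ⟪b + v, a' + z • u⟫ - ⟪b' + z • v, a + u⟫ =
      ⟪v, a' - conj z • a⟫ - ⟪b' - conj z • b, u⟫ + (z - conj z) * ⟪v, u⟫ := by
  have h := (mem_graph_iff_of_isSelfAdjoint hA).1 ha _ _ hb
  simp only [inner_add_left, inner_add_right, inner_sub_left, inner_sub_right, inner_smul_left,
    inner_smul_right, h, Complex.conj_conj]
  ring

variable (A B) in
/-- The difference of the resolvents, as a map between the defect subspaces. -/
def couplingOperator (z : ℂ) [(defectSubspace (A ⊓ B)† z).HasOrthogonalProjection] :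
    defectSubspace (A ⊓ B)† z →L[ℂ] defectSubspace (A ⊓ B)† z :=
  (defectSubspace (A ⊓ B)† z).orthogonalProjectionOnto ∘L
    (boundedResolvent B z - boundedResolvent A z) ∘L
    (1 + (conj z - z) • boundedResolvent A (conj z)) ∘L (defectSubspace (A ⊓ B)† z).subtypeL

variable (hA : IsSelfAdjoint A) (hB : IsSelfAdjoint B)
  (hS : Dense ((A ⊓ B : E →ₗ.[ℂ] E).domain : Set E)) {z : ℂ} (hz : z.im ≠ 0)

include hA hB hS hz in
-- Both resolvents solve (S* - z)f = h, so their difference solves the homogeneous equation.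
theorem boundedResolvent_sub_mem_defectSubspace (h : E) :
    boundedResolvent B z h - boundedResolvent A z h ∈ defectSubspace (A ⊓ B)† z := by
  have h1 := le_graph_of_le (le_adjoint_inf_right (A := A) hB hS)
    (boundedResolvent_mem_graph hB hz h)
  have h2 := le_graph_of_le (le_adjoint_inf_left (B := B) hA hS)
    (boundedResolvent_mem_graph hA hz h)
  rw [mem_defectSubspace]
  convert Submodule.sub_mem _ h1 h2 using 1
  ext <;> simp
  module

include hA hB hS hz in
/-- Elements of `dom B` decompose along `dom A` and the defect subspace. -/
theorem exists_decomposition {g g' : E} (hg : (g, g') ∈ B.graph) :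
    ∃ a a' u, (a, a') ∈ A.graph ∧ u ∈ defectSubspace (A ⊓ B)† z ∧ g = a + u ∧
      g' = a' + z • u := by
  have h1 := boundedResolvent_mem_graph hA hz (g' - z • g)
  have h2 := boundedResolvent_sub_mem_defectSubspace hA hB hS hz (g' - z • g)
  rw [boundedResolvent_sub_smul hB hz hg] at h2
  exact ⟨_, _, _, h1, h2, by abel, by module⟩

include hA hB hS hz in
-- Test against dom B: an element of dom B is a + u with a ∈ dom A, u ∈ N. The a-part obeys the
-- symmetry of A and the u-part drops out by orthogonality, so (d, d') is in the adjoint of B, which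
-- is B.
theorem mem_graph_right_of_orthogonal {d d' : E} (hd : (d, d') ∈ A.graph)
    (h : d' - conj z • d ∈ (defectSubspace (A ⊓ B)† z)ᗮ) : (d, d') ∈ B.graph := by
  rw [mem_graph_iff_of_isSelfAdjoint hB]
  intro g g' hg
  obtain ⟨a, a', u, ha, hu, rfl, rfl⟩ := exists_decomposition hA hB hS hz hg
  have h1 := (Submodule.mem_orthogonal _ _).1 h u hu
  have h2 := (mem_graph_iff_of_isSelfAdjoint hA).1 hd _ _ ha
  rw [inner_sub_right, inner_smul_right, sub_eq_zero] at h1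
  rw [inner_add_left, inner_add_left, inner_smul_left, h1, h2]

include hA hS hz in
/-- An element `w` of the defect subspace vanishes if `(A - z̄)⁻¹ w` lies in `dom B` and
`B` acts on it as `A` does. -/
theorem eq_zero_of_resolvent_mem_graph {w : E} (hw : w ∈ defectSubspace (A ⊓ B)† z)
    (h : (boundedResolvent A (conj z) w, w + conj z • boundedResolvent A (conj z) w) ∈ B.graph) :
    w = 0 := by
  have hz' : (conj z).im ≠ 0 := by simpa using hz
  have h1 := (mem_graph_adjoint_inf hS).1 (mem_defectSubspace.1 hw) _ _
    (boundedResolvent_mem_graph hA hz' w) h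
  rw [inner_add_left, inner_smul_left, Complex.conj_conj, inner_smul_right] at h1
  exact inner_self_eq_zero.1 (add_eq_right.1 h1)

variable [(defectSubspace (A ⊓ B)† z).HasOrthogonalProjection]

include hA hB hS hz in
theorem add_mem_graph_right_iff {a a' : E} (ha : (a, a') ∈ A.graph)
    (u : defectSubspace (A ⊓ B)† z) :
    (a + u, a' + z • (u : E)) ∈ B.graph ↔ u = couplingOperator A B z
      ((defectSubspace (A ⊓ B)† z).orthogonalProjectionOnto (a' - conj z • a)) := by
  let N := defectSubspace (A ⊓ B)† z
  let w : N := N.orthogonalProjectionOnto (a' - conj z • a)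
  have hz' : (conj z).im ≠ 0 := by simpa using hz
  have key : (a + couplingOperator A B z w, a' + z • (couplingOperator A B z w : E)) ∈
      B.graph := by
    have h0 := boundedResolvent_mem_graph hA hz' (w : E)
    let a0 := boundedResolvent A (conj z) w
    -- This is (A - z)a0, so (A - z)⁻¹h = a0 and a0 + Qw = (B - z)⁻¹h lies in dom B. The remaining a
    -- - a0 lies in dom S by the orthogonality criterion. Uniqueness of u holds because B has no
    -- nonreal eigenvalue.
    let h := (w : E) + (conj z - z) • a0
    have h1 : boundedResolvent A z h = a0 := by
      refine (congrArg (boundedResolvent A z) ?_).trans (boundedResolvent_sub_smul hA hz h0)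
      simp only [h, a0]
      module
    have h2 : (couplingOperator A B z w : E) = boundedResolvent B z h - boundedResolvent A z h :=
      Submodule.starProjection_eq_self_iff.2
        (boundedResolvent_sub_mem_defectSubspace hA hB hS hz h)
    have h3 : (a - a0, a' - ((w : E) + conj z • a0)) ∈ A.graph := A.graph.sub_mem ha h0
    have h4 : (a - a0, a' - ((w : E) + conj z • a0)) ∈ B.graph := by
      refine mem_graph_right_of_orthogonal hA hB hS hz h3 ?_
      convert N.sub_starProjection_mem_orthogonal (a' - conj z • a) using 1
      change _ = _ - (w : E)
      module
    have h5 := B.graph.add_mem h4 (boundedResolvent_mem_graph hB hz h)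
    rw [h2, h1]
    convert h5 using 1
    ext
    · simp
      abel
    · simp only [Prod.mk_add_mk, h]
      module
  constructor
  · intro hu
    change u = couplingOperator A B z w
    have h1 := B.graph.sub_mem hu key
    refine Subtype.ext (sub_eq_zero.1 (eq_zero_of_smul_mem_graph hB hz ?_))
    convert h1 using 1
    ext
    · simp only [Prod.fst_sub]
      abel
    · simp only [Prod.snd_sub]
      module
  · rintro rfl
    exact key

theorem orthogonalProjectionOnto_resolvent (w : defectSubspace (A ⊓ B)† z) : (defectSubspace (A ⊓ B)† z).orthogonalProjectionOnto
      (((w : E) + conj z • boundedResolvent A (conj z) w) -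
        conj z • boundedResolvent A (conj z) w) = w := by
  rw [add_sub_cancel_right]
  exact Submodule.orthogonalProjectionOnto_mem_subspace_eq_self w

include hA hB hS hz in
theorem resolvent_add_couplingOperator_mem_graph (w : defectSubspace (A ⊓ B)† z) :
    (boundedResolvent A (conj z) w + couplingOperator A B z w,
      ((w : E) + conj z • boundedResolvent A (conj z) w) + z • (couplingOperator A B z w : E)) ∈
      B.graph := by
  have hz' : (conj z).im ≠ 0 := by simpa using hz
  rw [add_mem_graph_right_iff hA hB hS hz (boundedResolvent_mem_graph hA hz' _),
    orthogonalProjectionOnto_resolvent]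

include hA hB hS hz in
-- If Qw = 0 then (A - z̄)⁻¹w belongs to dom S, so w lies in ran (S - z̄), which is orthogonal to N.
theorem couplingOperator_injective : Function.Injective (couplingOperator A B z) := by
  rw [injective_iff_map_eq_zero]
  intro w hw
  have := resolvent_add_couplingOperator_mem_graph hA hB hS hz w
  rw [hw] at this
  exact Subtype.ext (eq_zero_of_resolvent_mem_graph hA hS hz w.2 (by simpa using this))

include hA hB hS hz in
-- Green's identity for two elements of dom B: its left side vanishes by symmetry of B. Formally it
-- says that Q⁻¹ + (z - z̄)/2 is symmetric.
theorem inner_couplingOperator_sub (w₁ w₂ : defectSubspace (A ⊓ B)† z) :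
    ⟪w₁, couplingOperator A B z w₂⟫ - ⟪couplingOperator A B z w₁, w₂⟫ =
      (z - conj z) * ⟪couplingOperator A B z w₁, couplingOperator A B z w₂⟫ := by
  have hz' : (conj z).im ≠ 0 := by simpa using hz
  have h1 := green_identity hA z (boundedResolvent_mem_graph hA hz' (w₂ : E))
    (boundedResolvent_mem_graph hA hz' (w₁ : E)) (couplingOperator A B z w₂ : E)
    (couplingOperator A B z w₁ : E)
  rw [sub_eq_zero.2 ((mem_graph_iff_of_isSelfAdjoint hB).1
    (resolvent_add_couplingOperator_mem_graph hA hB hS hz w₂) _ _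
    (resolvent_add_couplingOperator_mem_graph hA hB hS hz w₁)).symm, add_sub_cancel_right,
    add_sub_cancel_right] at h1
  simp only [Submodule.coe_inner]
  linear_combination h1

include hA hB hS hz in
-- Density of ran Q, equivalently injectivity of Q*. For x orthogonal to ran Q, the vector (A -
-- z̄)⁻¹x pairs symmetrically with all of dom B, so it lies in dom B = dom B*, which forces x = 0.
theorem eq_zero_of_forall_inner_couplingOperator {x : defectSubspace (A ⊓ B)† z}
    (hx : ∀ w, ⟪couplingOperator A B z w, x⟫ = 0) : x = 0 := by
  have hz' : (conj z).im ≠ 0 := by simpa using hz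
  refine Subtype.ext (eq_zero_of_resolvent_mem_graph hA hS hz x.2 ?_)
  rw [mem_graph_iff_of_isSelfAdjoint hB]
  intro g g' hg
  obtain ⟨a, a', u, ha, hu, rfl, rfl⟩ := exists_decomposition hA hB hS hz hg
  have h1 := (add_mem_graph_right_iff hA hB hS hz ha ⟨u, hu⟩).1 hg
  have h2 : ⟪u, (x : E)⟫ = 0 := by
    have := hx ((defectSubspace (A ⊓ B)† z).orthogonalProjectionOnto (a' - conj z • a))
    rwa [← h1] at this
  have h3 := (mem_graph_iff_of_isSelfAdjoint hA).1 (boundedResolvent_mem_graph hA hz' (x : E)) _ _ ha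
  simp only [inner_add_left, inner_add_right, inner_smul_left, inner_smul_right] at h3 ⊢
  rw [h2]
  linear_combination h3

end CouplingOperator

/-! ### Boundary maps on `dom A + ran R` -/

section Coupling

open LinearPMap
open ContinuousLinearMap hiding domRestrict_apply
open scoped ComplexConjugate

theorem mem_graph_restrictKer {E : Type u} [NormedAddCommGroup E] [InnerProductSpace ℂ E]
    {H : Type v} [NormedAddCommGroup H] [InnerProductSpace ℂ H] {T : E →ₗ.[ℂ] E}
    {Γ : T.domain →ₗ[ℂ] H} {x y : E} :
    (x, y) ∈ (restrictKer T Γ).graph ↔ ∃ f : T.domain, Γ f = 0 ∧ (f : E) = x ∧ T f = y := by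
  rw [mem_graph_iff]
  constructor
  · rintro ⟨⟨x', ⟨f, hf, hfx⟩, hx⟩, rfl, rfl⟩
    exact ⟨f, hf, hfx, (domRestrict_apply hfx.symm).symm⟩
  · rintro ⟨f, hf, rfl, rfl⟩
    exact ⟨⟨f, ⟨f, hf, rfl⟩, f.2⟩, rfl, domRestrict_apply rfl⟩

variable {E : Type u} [NormedAddCommGroup E] [InnerProductSpace ℂ E] [CompleteSpace E]
variable {H : Type v} [NormedAddCommGroup H] [InnerProductSpace ℂ H] [CompleteSpace H]

/-- `T` acts on `dom A + ran R` as `A` on the first summand and as `z` on the second one, and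
`Γ₀ (a + R k) = k`, `Γ₁ (a + R k) = R* (A - z̄) a + C k`. -/
structure IsCoupling (A : E →ₗ.[ℂ] E) (z : ℂ) (R : H →L[ℂ] E) (C : H →L[ℂ] H) (T : E →ₗ.[ℂ] E)
    (Γ₀ Γ₁ : T.domain →ₗ[ℂ] H) : Prop where
  exists_eq : ∀ f : T.domain, ∃ (a : A.domain) (k : H), (f : E) = a + R k
  mem_domain : ∀ (a : A.domain) (k : H), (a + R k : E) ∈ T.domain
  apply_eq : ∀ (f : T.domain) (a : A.domain) (k : H), (f : E) = a + R k → T f = A a + z • R k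
  zero_apply : ∀ (f : T.domain) (a : A.domain) (k : H), (f : E) = a + R k → Γ₀ f = k
  one_apply : ∀ (f : T.domain) (a : A.domain) (k : H), (f : E) = a + R k →
    Γ₁ f = adjoint R (A a - conj z • (a : E)) + C k

variable {A : E →ₗ.[ℂ] E} {z : ℂ} {R : H →L[ℂ] E} {C : H →L[ℂ] H}

/-- The hypothesis makes the representation a + Rk unique, so formulas in (a, k) define operators on
dom A + ran R. -/
theorem exists_isCoupling (hR : ∀ (a : A.domain) (k : H), (a : E) + R k = 0 → k = 0) :
    ∃ (T : E →ₗ.[ℂ] E) (Γ₀ Γ₁ : T.domain →ₗ[ℂ] H), IsCoupling A z R C T Γ₀ Γ₁ := by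
  let Φ : A.domain × H →ₗ[ℂ] E := A.domain.subtype.coprod (R : H →ₗ[ℂ] E)
  have hΦ : ∀ x, Φ x = x.1 + R x.2 := fun x => rfl
  have hinj : Function.Injective Φ := by
    rw [injective_iff_map_eq_zero]
    rintro ⟨a, k⟩ h
    have hk : k = 0 := hR a k h
    subst hk
    rw [hΦ, _root_.map_zero, add_zero] at h
    rw [show a = 0 from Subtype.ext h]; rfl
  let e := LinearEquiv.ofInjective Φ hinj
  have he : ∀ (f : LinearMap.range Φ) (a : A.domain) (k : H), (f : E) = a + R k →
      e.symm f = (a, k) := by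
    intro f a k h
    rw [LinearEquiv.symm_apply_eq]
    exact Subtype.ext h
  refine ⟨⟨LinearMap.range Φ, (A.toFun.coprod (z • (R : H →ₗ[ℂ] E))) ∘ₗ (e.symm : _ →ₗ[ℂ] _)⟩,
    LinearMap.snd ℂ A.domain H ∘ₗ (e.symm : _ →ₗ[ℂ] _),
    (((adjoint R : E →ₗ[ℂ] H) ∘ₗ (A.toFun - conj z • A.domain.subtype)).coprod
      (C : H →ₗ[ℂ] H)) ∘ₗ (e.symm : _ →ₗ[ℂ] _), ?_, ?_, ?_, ?_, ?_⟩
  · rintro ⟨_, ⟨⟨a, k⟩, rfl⟩⟩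
    exact ⟨a, k, rfl⟩
  · exact fun a k => ⟨(a, k), rfl⟩
  · intro f a k h
    change (A.toFun.coprod (z • (R : H →ₗ[ℂ] E))) (e.symm f) = _
    rw [he f a k h]; rfl
  · intro f a k h
    change (e.symm f).2 = _
    rw [he f a k h]
  · intro f a k h
    change (((adjoint R : E →ₗ[ℂ] H) ∘ₗ (A.toFun - conj z • A.domain.subtype)).coprod
      (C : H →ₗ[ℂ] H)) (e.symm f) = _
    rw [he f a k h]; rfl

namespace IsCoupling

variable {T : E →ₗ.[ℂ] E} {Γ₀ Γ₁ : T.domain →ₗ[ℂ] H} (h : IsCoupling A z R C T Γ₀ Γ₁)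

include h

theorem restrictKer_zero : A = restrictKer T Γ₀ := by
  refine eq_of_eq_graph ?_
  ext ⟨x, y⟩
  rw [mem_graph_restrictKer, mem_graph_iff]
  constructor
  · rintro ⟨a, rfl, rfl⟩
    have ha : (a : E) = a + R 0 := by simp
    have hm : (a : E) ∈ T.domain := by rw [ha]; exact h.mem_domain a 0
    exact ⟨⟨a, hm⟩, h.zero_apply _ a 0 ha, rfl, by rw [h.apply_eq _ a 0 ha]; simp⟩
  · rintro ⟨f, hf, rfl, rfl⟩
    obtain ⟨a, k, hak⟩ := h.exists_eq f
    rw [h.zero_apply f a k hak] at hf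
    subst hf
    exact ⟨a, by simp [hak], by simp [h.apply_eq f a 0 hak]⟩

/-- `ker Γ₁` is the domain of `B` as soon as `Γ₁ (a + R k) = 0` describes the elements of `B`. -/
theorem restrictKer_one {B : E →ₗ.[ℂ] E}
    (hB : ∀ a a' u, (a, a') ∈ A.graph → ((a + u, a' + z • u) ∈ B.graph ↔
      ∃ k, u = R k ∧ adjoint R (a' - conj z • a) + C k = 0))
    (hdec : ∀ g g', (g, g') ∈ B.graph → ∃ a a' u, (a, a') ∈ A.graph ∧ g = a + u ∧
      g' = a' + z • u) : B = restrictKer T Γ₁ := by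
  refine eq_of_eq_graph ?_
  ext ⟨x, y⟩
  rw [mem_graph_restrictKer]
  constructor
  · intro hxy
    obtain ⟨a, a', u, ha, rfl, rfl⟩ := hdec x y hxy
    obtain ⟨k, rfl, hk⟩ := (hB a a' u ha).1 hxy
    obtain ⟨a, rfl, rfl⟩ := (mem_graph_iff _).1 ha
    exact ⟨⟨_, h.mem_domain a k⟩, by rw [h.one_apply _ a k rfl]; exact hk, rfl,
      h.apply_eq _ a k rfl⟩
  · rintro ⟨f, hf, rfl, rfl⟩
    obtain ⟨a, k, hak⟩ := h.exists_eq f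
    rw [h.one_apply f a k hak] at hf
    rw [h.apply_eq f a k hak, hak]
    exact (hB a (A a) (R k) (A.mem_graph a)).2 ⟨k, rfl, hf⟩

/-- The terms coupling a with R are matched by R* in Γ₁; what remains is (z - z̄)(Rk, Rl), which the
skew part of C absorbs. -/
theorem green (hA : IsSelfAdjoint A)
    (hC : ∀ k l, ⟪k, C l⟫ - ⟪C k, l⟫ = (z - conj z) * ⟪R k, R l⟫) (f g : T.domain) :
    ⟪(g : E), T f⟫ - ⟪T g, (f : E)⟫ = ⟪Γ₀ g, Γ₁ f⟫ - ⟪Γ₁ g, Γ₀ f⟫ := by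
  obtain ⟨a, k, hf⟩ := h.exists_eq f
  obtain ⟨b, l, hg⟩ := h.exists_eq g
  rw [h.apply_eq f a k hf, h.apply_eq g b l hg, h.zero_apply f a k hf, h.zero_apply g b l hg,
    h.one_apply f a k hf, h.one_apply g b l hg, hf, hg,
    green_identity hA z (A.mem_graph a) (A.mem_graph b), inner_add_right, inner_add_left,
    adjoint_inner_right, adjoint_inner_left]
  linear_combination -hC l k

/-- T lies between graph A + graph B and the closed graph of S*, in which the former is dense. -/
theorem isClosable_and_closure_eq {B : E →ₗ.[ℂ] E} (hA : IsSelfAdjoint A) (hB : IsSelfAdjoint B)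
    (hS : Dense ((A ⊓ B : E →ₗ.[ℂ] E).domain : Set E))
    (hR : ∀ k, R k ∈ defectSubspace (A ⊓ B)† z) (hBT : B = restrictKer T Γ₁) :
    T.IsClosable ∧ T.closure = (A ⊓ B)† := by
  have hTS : T ≤ (A ⊓ B)† := by
    refine le_of_le_graph fun ⟨x, y⟩ hxy => ?_
    obtain ⟨f, rfl, rfl⟩ := (mem_graph_iff _).1 hxy
    obtain ⟨a, k, hak⟩ := h.exists_eq f
    rw [h.apply_eq f a k hak, hak]
    exact Submodule.add_mem _ (le_graph_of_le (le_adjoint_inf_left hA hS) (A.mem_graph a)) (hR k)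
  have hAT : A ≤ T := by rw [h.restrictKer_zero]; exact domRestrict_le
  have hBT' : B ≤ T := by rw [hBT]; exact domRestrict_le
  have hcl := (adjoint_isClosed hS).isClosable.leIsClosable hTS
  refine ⟨hcl, eq_of_eq_graph ?_⟩
  rw [← hcl.graph_closure_eq_closure_graph]
  refine le_antisymm (Submodule.topologicalClosure_minimal _ (le_graph_of_le hTS)
    (adjoint_isClosed hS)) ?_
  rw [← topologicalClosure_sup_graph hA hB hS]
  exact Submodule.topologicalClosure_mono
    (sup_le (le_graph_of_le hAT) (le_graph_of_le hBT'))

theorem surjective_zero : Function.Surjective Γ₀ := fun k =>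
  ⟨⟨_, h.mem_domain 0 k⟩, h.zero_apply _ 0 k rfl⟩

theorem isBGeneralizedBoundaryTriple {B : E →ₗ.[ℂ] E} (hA : IsSelfAdjoint A)
    (hB : IsSelfAdjoint B) (hS : Dense ((A ⊓ B : E →ₗ.[ℂ] E).domain : Set E))
    (hR : ∀ k, R k ∈ defectSubspace (A ⊓ B)† z) (hBT : B = restrictKer T Γ₁)
    (hC : ∀ k l, ⟪k, C l⟫ - ⟪C k, l⟫ = (z - conj z) * ⟪R k, R l⟫) :
    IsBGeneralizedBoundaryTriple (A ⊓ B) T Γ₀ Γ₁ where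
  isClosable := (h.isClosable_and_closure_eq hA hB hS hR hBT).1
  closure_eq := (h.isClosable_and_closure_eq hA hB hS hR hBT).2
  green := h.green hA hC
  selfAdjoint_zero := h.restrictKer_zero ▸ hA
  surjective_zero := h.surjective_zero

/-- The solution `f ∈ ker (T - w)` of `Γ₀ f = k`. -/
theorem exists_mem_kerSub (hA : IsSelfAdjoint A) {w : ℂ} (hw : w.im ≠ 0) (k : H) :
    ∃ f ∈ kerSub T w, Γ₀ f = k ∧ Γ₁ f = adjoint R ((w - z) • (R k +
      (w - conj z) • boundedResolvent A w (R k))) + C k := by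
  -- The choice a = (w - z)(A - w)⁻¹Rk is forced by (T - w)(a + Rk) = (A - w)a + (z - w)Rk = 0.
  obtain ⟨a, ha, ha'⟩ := (mem_graph_iff _).1
    (boundedResolvent_mem_graph hA hw ((w - z) • R k))
  dsimp only at ha ha'
  refine ⟨⟨_, h.mem_domain a k⟩, ?_, h.zero_apply _ a k rfl, ?_⟩
  · rw [kerSub, LinearMap.mem_ker]
    change T _ - w • ((a : E) + R k) = 0
    rw [h.apply_eq _ a k rfl, ha', ha]
    module
  · rw [h.one_apply _ a k rfl, ha', ha, _root_.map_smul]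
    congr 2
    module

theorem eq_zero_of_mem_kerSub (hA : IsSelfAdjoint A) {w : ℂ} (hw : w.im ≠ 0) {f : T.domain}
    (hf : f ∈ kerSub T w) (h0 : Γ₀ f = 0) : f = 0 := by
  have h1 : ((f : E), T f) ∈ A.graph := by
    rw [h.restrictKer_zero]; exact mem_graph_restrictKer.2 ⟨f, h0, rfl, rfl⟩
  have h2 : T f - w • (f : E) = 0 := hf
  rw [sub_eq_zero.1 h2] at h1
  exact Subtype.ext (eq_zero_of_smul_mem_graph hA hw h1)

theorem isBoundedOp_weylFunction (hA : IsSelfAdjoint A) {w : ℂ} (hw : w.im ≠ 0) :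
    IsBoundedOp (weylFunction T Γ₀ Γ₁ w)
      (adjoint R ∘L ((w - z) • (1 + (w - conj z) • boundedResolvent A w)) ∘L R + C) := by
  have hker : LinearMap.ker (Γ₀.toPMap (kerSub T w)).toFun = ⊥ := by
    rw [LinearMap.ker_eq_bot']
    intro f hf
    exact Subtype.ext (h.eq_zero_of_mem_kerSub hA hw f.2 hf)
  have hval : ∀ k : H, ∃ f : (Γ₀.toPMap (kerSub T w)).domain, Γ₀.toPMap (kerSub T w) f = k ∧
      Γ₁ f = (adjoint R ∘L ((w - z) • (1 + (w - conj z) • boundedResolvent A w)) ∘L R + C) k := by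
    intro k
    obtain ⟨f, hf, h0, h1⟩ := h.exists_mem_kerSub hA hw k
    exact ⟨⟨f, hf⟩, h0, h1⟩
  have hdom : (weylFunction T Γ₀ Γ₁ w).domain = ⊤ := by
    rw [eq_top_iff]
    rintro k -
    obtain ⟨f, hf, -⟩ := hval k
    change k ∈ (Γ₀.toPMap (kerSub T w)).inverse.domain
    rw [inverse_domain]
    exact ⟨f, hf⟩
  refine LinearPMap.ext hdom fun k hk _ => ?_
  obtain ⟨f, hf, hf'⟩ := hval k
  change Γ₁ ((Γ₀.toPMap (kerSub T w)).inverse ⟨k, hk⟩) = _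
  rw [inverse_apply_eq hker (y := ⟨k, hk⟩) (x := f) hf]
  exact hf'

/-- Green's identity at f = γ(w)k, that is Im M(w) = Im w · γ(w)*γ(w). Injectivity of γ(w) is what
makes the function strict. -/
theorem inner_weyl_sub (hA : IsSelfAdjoint A)
    (hC : ∀ k l, ⟪k, C l⟫ - ⟪C k, l⟫ = (z - conj z) * ⟪R k, R l⟫) {w : ℂ} (hw : w.im ≠ 0) (k : H)
    {M : H →L[ℂ] H}
    (hM : M = adjoint R ∘L ((w - z) • (1 + (w - conj z) • boundedResolvent A w)) ∘L R + C) :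
    ∃ f : E, ⟪k, M k⟫ - ⟪M k, k⟫ = (w - conj w) * (‖f‖ : ℂ) ^ 2 ∧ (f = 0 → k = 0) := by
  obtain ⟨f, hf, h0, h1⟩ := h.exists_mem_kerSub hA hw k
  have h2 : T f = w • (f : E) := sub_eq_zero.1 hf
  have h3 : Γ₁ f = M k := by rw [h1, hM]; rfl
  refine ⟨f, ?_, fun hf0 => ?_⟩
  · rw [← h3, ← h0, ← h.green hA hC f f, h2, inner_smul_left, inner_smul_right,
      inner_self_eq_norm_sq_to_K]
    simp only [Complex.coe_algebraMap]
    ring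
  · rw [← h0, show f = 0 from Subtype.ext hf0, _root_.map_zero]

end IsCoupling

/-! ### Nevanlinna functions -/

theorem inner_imPart (M : H →L[ℂ] H) (k : H) :
    ⟪k, imPart M k⟫ = (2 * Complex.I)⁻¹ * (⟪k, M k⟫ - ⟪M k, k⟫) := by
  simp [imPart, inner_smul_right, inner_sub_right, adjoint_inner_right]

theorem isSelfAdjoint_imPart (M : H →L[ℂ] H) : IsSelfAdjoint (imPart M) := by
  rw [imPart, IsSelfAdjoint, star_smul, star_sub, ← star_eq_adjoint, star_star, ← neg_sub M,
    smul_neg, ← neg_smul]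
  congr 1
  simp

theorem isStrictNevanlinna_of_inner {G : Type*} [NormedAddCommGroup G] {M : ℂ → H →L[ℂ] H}
    (hd : DifferentiableOn ℂ M {w | 0 < w.im})
    (hM : ∀ w : ℂ, 0 < w.im → ∀ k, ∃ f : G,
      ⟪k, M w k⟫ - ⟪M w k, k⟫ = (w - conj w) * (‖f‖ : ℂ) ^ 2 ∧ (f = 0 → k = 0)) :
    IsStrictNevanlinna M := by
  have key : ∀ w : ℂ, 0 < w.im → ∀ k, ∃ f : G,
      ⟪k, imPart (M w) k⟫ = ((w.im * ‖f‖ ^ 2 : ℝ) : ℂ) ∧ (f = 0 → k = 0) := by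
    intro w hw k
    obtain ⟨f, hf, hf'⟩ := hM w hw k
    refine ⟨f, ?_, hf'⟩
    rw [inner_imPart, hf, Complex.sub_conj]
    push_cast
    have := Complex.I_ne_zero
    field_simp
  refine ⟨⟨hd, fun w hw => ?_⟩, fun w hw k hk => ?_⟩
  · refine (isPositive_iff_complex _).2 fun k => ?_
    obtain ⟨f, hf, -⟩ := key w hw k
    have hs : ⟪imPart (M w) k, k⟫ = ⟪k, imPart (M w) k⟫ :=
      (isSelfAdjoint_imPart (M w)).isSymmetric k k
    rw [hs, hf]
    refine ⟨by rw [RCLike.re_to_complex, Complex.ofReal_re], ?_⟩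
    simp only [Complex.ofReal_re, RCLike.re_to_complex]
    positivity
  · obtain ⟨f, hf, hf'⟩ := key w hw k
    rw [hk, inner_zero_right] at hf
    have h1 : w.im * ‖f‖ ^ 2 = 0 := by exact_mod_cast hf.symm
    exact hf' (by simpa [hw.ne'] using h1)

theorem differentiableOn_weyl (hA : IsSelfAdjoint A) :
    DifferentiableOn ℂ (fun w : ℂ => adjoint R ∘L
      ((w - z) • (1 + (w - conj z) • boundedResolvent A w)) ∘L R + C) {w | 0 < w.im} := by
  intro w hw
  have h1 := differentiableAt_boundedResolvent hA hw
  have h2 : DifferentiableAt ℂ (fun w : ℂ =>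
      (w - z) • ((1 : E →L[ℂ] E) + (w - conj z) • boundedResolvent A w)) w := by
    fun_prop
  refine DifferentiableAt.differentiableWithinAt ?_
  refine DifferentiableAt.add_const _ ?_
  exact ((differentiableAt_const _).clm_comp (h2.clm_comp (differentiableAt_const _)))

end Coupling

/-! ### Factorization of injective self-adjoint operators, shifts by real numbers -/

section Factorization

open ContinuousLinearMap
open scoped ComplexConjugate

variable {H : Type v} [NormedAddCommGroup H] [InnerProductSpace ℂ H] [CompleteSpace H]

/-- The square root of `|D|` for an injective self-adjoint `D`. -/
theorem exists_sqrt_abs {D : H →L[ℂ] H} (hD : IsSelfAdjoint D) (hinj : ∀ x, D x = 0 → x = 0) :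
    ∃ R : H →L[ℂ] H, IsSelfAdjoint R ∧ (∀ x, R x = 0 → x = 0) ∧ Commute R D ∧
      (R * R) * (R * R) = D * D := by
  have hP0 : 0 ≤ CFC.abs D := CFC.abs_nonneg D
  have hPP : CFC.abs D * CFC.abs D = D * D := by
    have := CFC.abs_mul_abs D
    rwa [hD.star_eq] at this
  have hRR : CFC.sqrt (CFC.abs D) * CFC.sqrt (CFC.abs D) = CFC.abs D :=
    CFC.sqrt_mul_sqrt_self _ hP0
  refine ⟨CFC.sqrt (CFC.abs D), (CFC.sqrt_nonneg _).isSelfAdjoint, fun x hx => ?_,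
    Commute.cfcₙ_nnreal (CFC.commute_abs_self D hD.isStarNormal) _, by rw [hRR, hPP]⟩
  have h1 : CFC.abs D x = 0 := by
    rw [← hRR, mul_apply_eq_comp, hx, map_zero]
  refine hinj x (norm_eq_zero.1 ?_)
  rw [← norm_abs_apply]
  exact norm_eq_zero.2 h1

/-- The reflection `J` in `ker (P - D)` intertwines `P` and `D`. -/
theorem exists_reflection {P D : H →L[ℂ] H} (hP : IsSelfAdjoint P) (hD : IsSelfAdjoint D)
    (hPD : Commute P D) (hPP : P * P = D * D) :
    ∃ J : H →L[ℂ] H, IsSelfAdjoint J ∧ J * J = 1 ∧ J * P = D := by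
  let K : Submodule ℂ H := LinearMap.ker ((P - D : H →L[ℂ] H) : H →ₗ[ℂ] H)
  have hK : IsClosed (K : Set H) := (P - D).isClosed_ker
  have : CompleteSpace K := hK.completeSpace_coe
  obtain ⟨S, hSdef⟩ : ∃ S, K.starProjection = S := ⟨_, rfl⟩
  have hS : IsSelfAdjoint S := hSdef ▸ isSelfAdjoint_starProjection K
  have hSS : S * S = S := hSdef ▸ K.isIdempotentElem_starProjection
  -- (P - D)(P + D) = 0 puts ran (P + D) into ker (P - D), while S annihilates ran (P - D). Adding
  -- the two relations gives 2SP = P + D, so J = 2S - 1 satisfies JP = D.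
  have hplus : ∀ x, S ((P + D) x) = (P + D) x := by
    intro x
    rw [← hSdef]
    refine Submodule.starProjection_eq_self_iff.2 ?_
    have h1 : (P - D) * (P + D) = 0 := by
      rw [sub_mul, mul_add, mul_add, hPD.eq, hPP]
      abel
    exact DFunLike.congr_fun h1 x
  have hminus : ∀ x, S ((P - D) x) = 0 := by
    intro x
    rw [← hSdef]
    refine (Submodule.starProjection_apply_eq_zero_iff _).2 ((Submodule.mem_orthogonal _ _).2 ?_)
    intro y hy
    have h1 : ⟪(P - D) y, x⟫ = ⟪y, (P - D) x⟫ := (hP.sub hD).isSymmetric y x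
    rw [← h1, show (P - D) y = 0 from hy, inner_zero_left]
  refine ⟨S + S - 1, (hS.add hS).sub (.one _), ?_, ?_⟩
  · rw [sub_mul, mul_sub, add_mul, mul_add, hSS, mul_one, one_mul]
    abel
  · ext x
    have h3 := hplus x
    have h4 := hminus x
    rw [add_apply, map_add] at h3
    rw [sub_apply, map_sub, sub_eq_zero] at h4
    rw [← h4] at h3
    change S (P x) + S (P x) - P x = D x
    rw [h3]
    abel

/-- With `R = |D|^{1/2}` and a self-adjoint unitary `J`, the polar decomposition `|D| = J D` can be
written symmetrically as `D = R J R`. -/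
theorem exists_symmetric_factorization {D : H →L[ℂ] H} (hD : IsSelfAdjoint D)
    (hinj : ∀ x, D x = 0 → x = 0) :
    ∃ R J : H →L[ℂ] H, IsSelfAdjoint R ∧ (∀ x, R x = 0 → x = 0) ∧ IsSelfAdjoint J ∧ J * J = 1 ∧
      R * J * R = D ∧ R * R = J * D := by
  obtain ⟨R, hR, hRinj, hRD, hPP⟩ := exists_sqrt_abs hD hinj
  have hP : IsSelfAdjoint (R * R) := by
    rw [IsSelfAdjoint, star_mul, hR.star_eq]
  obtain ⟨J, hJ, hJJ, hJP⟩ := exists_reflection hP hD (hRD.mul_left hRD) hPP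
  have hX : IsSelfAdjoint (R * J * R - D) := by
    refine IsSelfAdjoint.sub ?_ hD
    rw [IsSelfAdjoint, star_mul, star_mul, hR.star_eq, hJ.star_eq, mul_assoc]
  -- The self-adjoint X = RJR - D satisfies XR = 0, hence RX = 0, and R is injective. This avoids
  -- proving that J commutes with R.
  have hXR : (R * J * R - D) * R = 0 := by
    rw [sub_mul, mul_assoc (R * J), mul_assoc R J, hJP, hRD.eq, sub_self]
  have hRX : R * (R * J * R - D) = 0 := by
    have := congrArg star hXR
    rwa [star_mul, hX.star_eq, hR.star_eq, star_zero] at this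
  refine ⟨R, J, hR, hRinj, hJ, hJJ, ?_, ?_⟩
  · rw [← sub_eq_zero]
    ext x
    exact hRinj _ (DFunLike.congr_fun hRX x)
  · rw [← hJP, ← mul_assoc J, hJJ, one_mul]

variable {Q : H →L[ℂ] H} {z : ℂ}
  (hQ : ∀ x y, ⟪x, Q y⟫ - ⟪Q x, y⟫ = (z - conj z) * ⟪Q x, Q y⟫)

include hQ in
/-- Formally, `Q⁻¹ + (z - z̄) / 2` is self-adjoint with compact resolvent, so all but countably many
real numbers belong to its resolvent set. -/
theorem exists_isUnit_one_add_smul [TopologicalSpace.SeparableSpace H] (hz : z.im ≠ 0)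
    (hQc : IsCompactOperator Q) :
    ∃ c : ℂ, c - conj c = z - conj z ∧ IsUnit (1 + c • Q) := by
  by_contra! hcon
  let c : ℝ → ℂ := fun t => z.im * Complex.I - t
  have hc : ∀ t, c t - conj (c t) = z - conj z := by
    intro t
    rw [Complex.sub_conj, Complex.sub_conj]
    simp [c]
  have hc0 : ∀ t, c t ≠ 0 := by
    intro t h
    have : (c t).im = 0 := by rw [h]; rfl
    simp [c] at this
    exact hz this
  -- Only the real part of c is free. By the Fredholm alternative, if 1 + cQ is never invertible,
  -- each real t yields an eigenvector.
  have hev : ∀ t, ∃ x : H, x ≠ 0 ∧ x = -(c t • Q x) := by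
    intro t
    have hμ : -(c t)⁻¹ ≠ 0 := neg_ne_zero.2 (inv_ne_zero (hc0 t))
    rcases hQc.hasEigenvalue_or_mem_resolventSet hμ with h | h
    · obtain ⟨x, hx⟩ := h.exists_hasEigenvector
      refine ⟨x, hx.2, ?_⟩
      have h1 : Q x = -(c t)⁻¹ • x := hx.apply_eq_smul
      rw [h1, smul_smul, mul_neg, mul_inv_cancel₀ (hc0 t), neg_smul, neg_neg, one_smul]
    · exfalso
      apply hcon (c t) (hc t)
      rw [spectrum.mem_resolventSet_iff] at h
      have h2 : 1 + c t • Q = (-(c t)) • (algebraMap ℂ (H →L[ℂ] H) (-(c t)⁻¹) - Q) := by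
        rw [Algebra.algebraMap_eq_smul_one, smul_sub, smul_smul, neg_mul_neg,
          mul_inv_cancel₀ (hc0 t), one_smul, neg_smul, sub_neg_eq_add]
      rw [h2]
      exact h.smul (Units.mk0 _ (neg_ne_zero.2 (hc0 t)))
  choose x hx0 hx using hev
  have horth : ∀ s t, s ≠ t → ⟪x s, x t⟫ = 0 := by
    intro s t hst
    have h1 := hQ (x s) (x t)
    have h2 : ⟪x s, Q (x t)⟫ = -(conj (c s) * ⟪Q (x s), Q (x t)⟫) := by
      conv_lhs => rw [hx s]
      rw [inner_neg_left, inner_smul_left]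
    have h3 : ⟪Q (x s), x t⟫ = -(c t * ⟪Q (x s), Q (x t)⟫) := by
      conv_lhs => rw [hx t]
      rw [inner_neg_right, inner_smul_right]
    have h4 : ((s : ℂ) - t) * ⟪Q (x s), Q (x t)⟫ = 0 := by
      rw [h2, h3, ← hc t] at h1
      simp only [c, map_sub, map_mul, Complex.conj_ofReal, Complex.conj_I] at h1
      linear_combination h1
    have h5 := (mul_eq_zero.1 h4).resolve_left
      (sub_ne_zero.2 (fun h => hst (Complex.ofReal_injective h)))
    rw [hx s, hx t, inner_neg_left, inner_neg_right, inner_smul_left, inner_smul_right, h5]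
    simp
  let e : ℝ → H := fun t => ((‖x t‖ : ℂ)⁻¹) • x t
  have he : ∀ t, ‖e t‖ = 1 := fun t => by
    simp [e, norm_smul, hx0 t]
  have heo : ∀ s t, s ≠ t → ⟪e s, e t⟫ = 0 := fun s t hst => by
    simp only [e, inner_smul_left, inner_smul_right, horth s t hst, mul_zero]
  have hdist : ∀ s t, s ≠ t → 1 ≤ dist (e s) (e t) := by
    intro s t hst
    rw [dist_eq_norm]
    have h1 := norm_sub_sq (𝕜 := ℂ) (e s) (e t)
    rw [heo s t hst, he, he, map_zero] at h1
    nlinarith [norm_nonneg (e s - e t)]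
  -- The normalized eigenvectors are orthonormal and indexed by ℝ; disjoint balls around them
  -- contradict separability.
  have hdisj : (Set.univ : Set ℝ).PairwiseDisjoint fun t => Metric.ball (e t) (1 / 2) := by
    intro s _ t _ hst
    refine Metric.ball_disjoint_ball ?_
    have := hdist s t hst
    linarith
  have := hdisj.countable_of_isOpen (fun _ _ => Metric.isOpen_ball)
    (fun t _ => ⟨e t, Metric.mem_ball_self (by norm_num)⟩)
  exact Cardinal.not_countable_real this

include hQ in
/-- Formally, `D = (Q⁻¹ + c)⁻¹`. -/
theorem exists_shift (hinj : ∀ x, Q x = 0 → x = 0) {c : ℂ} (hc : c - conj c = z - conj z)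
    (hu : IsUnit (1 + c • Q)) :
    ∃ Y : H →L[ℂ] H, IsSelfAdjoint (Q * Y) ∧ (∀ x, (Q * Y) x = 0 → x = 0) ∧
      ∀ u w, u = Q w ↔ u = (Q * Y) (w + c • u) := by
  obtain ⟨U, hU⟩ := hu
  let Y : H →L[ℂ] H := ((U⁻¹ : (H →L[ℂ] H)ˣ) : H →L[ℂ] H)
  have hYU : ∀ b, Y (b + c • Q b) = b := by
    intro b
    have h1 : b + c • Q b = (U : H →L[ℂ] H) b := by rw [hU]; rfl
    rw [h1]
    exact DFunLike.congr_fun (U.inv_mul) b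
  have hsurj : ∀ x, ∃ b, x = b + c • Q b := by
    intro x
    refine ⟨Y x, ?_⟩
    have h1 : Y x + c • Q (Y x) = (U : H →L[ℂ] H) (Y x) := by rw [hU]; rfl
    rw [h1]
    exact (DFunLike.congr_fun (U.mul_inv) x).symm
  have hD : ∀ b, (Q * Y) (b + c • Q b) = Q b := fun b => by rw [mul_apply_eq_comp, hYU]
  refine ⟨Y, ?_, ?_, ?_⟩
  · rw [isSelfAdjoint_iff_isSymmetric]
    intro x y
    obtain ⟨a, rfl⟩ := hsurj x
    obtain ⟨b, rfl⟩ := hsurj y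
    change ⟪(Q * Y) _, _⟫ = ⟪_, (Q * Y) _⟫
    rw [hD, hD]
    simp only [inner_add_left, inner_add_right, inner_smul_left, inner_smul_right]
    linear_combination ⟪Q a, Q b⟫ * hc - hQ a b
  · intro x hx
    obtain ⟨b, rfl⟩ := hsurj x
    rw [hD] at hx
    rw [hinj b hx, map_zero, smul_zero, add_zero]
  · intro u w
    constructor
    · rintro rfl
      exact (hD w).symm
    · intro hu
      obtain ⟨b, hb⟩ := hsurj (w + c • u)
      rw [hb, hD] at hu
      rw [hu] at hb ⊢
      rw [add_right_cancel hb]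

end Factorization

/-! ### Boundary triples for the intersection of two self-adjoint operators -/

section Intersection

open LinearPMap ContinuousLinearMap
open scoped ComplexConjugate

variable {E : Type u} [NormedAddCommGroup E] [InnerProductSpace ℂ E] [CompleteSpace E]
variable {A B : E →ₗ.[ℂ] E} (hA : IsSelfAdjoint A) (hB : IsSelfAdjoint B)
  (hS : Dense ((A ⊓ B : E →ₗ.[ℂ] E).domain : Set E)) {z : ℂ} (hz : z.im ≠ 0)

include hA hS hz in
theorem eq_zero_of_add_defectSubspace (a : A.domain) {u : E}
    (hu : u ∈ defectSubspace (A ⊓ B)† z) (h : (a : E) + u = 0) : u = 0 := by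
  have h1 := Submodule.add_mem _ (le_graph_of_le (le_adjoint_inf_left (B := B) hA hS)
    (A.mem_graph a)) (mem_defectSubspace.1 hu)
  have h2 : A a + z • u = 0 := graph_fst_eq_zero_snd _ h1 h
  have h3 : ((a : E), z • (a : E)) ∈ A.graph := by
    convert A.mem_graph a using 2
    rw [eq_neg_of_add_eq_zero_left h2, eq_neg_of_add_eq_zero_left h, smul_neg]
  rw [eq_zero_of_smul_mem_graph hA hz h3, zero_add] at h
  exact h

include hA hB hS in
theorem mem_defectSubspace_of_mem_graph {a a' u : E} (ha : (a, a') ∈ A.graph)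
    (h : (a + u, a' + z • u) ∈ B.graph) : u ∈ defectSubspace (A ⊓ B)† z := by
  have h1 := Submodule.sub_mem _ (le_graph_of_le (le_adjoint_inf_right (A := A) hB hS) h)
    (le_graph_of_le (le_adjoint_inf_left (B := B) hA hS) ha)
  simpa [mem_defectSubspace] using h1

variable [CompleteSpace (defectSubspace (A ⊓ B)† z)]

include hA hB hS hz in
/-- For `Γ₁ (a + R k) = R* (A - z̄) a + C k` with `R` taking values in the defect subspace, the
condition `B = T ↾ ker Γ₁` in terms of the coupling operator. -/
theorem IsCoupling.eq_restrictKer_one {H : Type v} [NormedAddCommGroup H] [InnerProductSpace ℂ H]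
    [CompleteSpace H] {R : H →L[ℂ] defectSubspace (A ⊓ B)† z} {C : H →L[ℂ] H} {T : E →ₗ.[ℂ] E}
    {Γ₀ Γ₁ : T.domain →ₗ[ℂ] H}
    (h : IsCoupling A z ((defectSubspace (A ⊓ B)† z).subtypeL ∘L R) C T Γ₀ Γ₁)
    (hRC : ∀ u w, u = couplingOperator A B z w ↔ ∃ k, u = R k ∧ adjoint R w + C k = 0) :
    B = restrictKer T Γ₁ := by
  refine h.restrictKer_one (fun a a' u ha => ?_) fun g g' hg => ?_
  · have hadj : ∀ x : E, adjoint ((defectSubspace (A ⊓ B)† z).subtypeL ∘L R) x =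
        adjoint R ((defectSubspace (A ⊓ B)† z).orthogonalProjectionOnto x) := by
      intro x
      rw [adjoint_comp, Submodule.adjoint_subtypeL]
      rfl
    simp only [hadj]
    constructor
    · intro hB'
      have hu := mem_defectSubspace_of_mem_graph hA hB hS ha hB'
      obtain ⟨k, hk, hk'⟩ := (hRC _ _).1
        ((add_mem_graph_right_iff hA hB hS hz ha ⟨u, hu⟩).1 hB')
      exact ⟨k, congrArg Subtype.val hk, hk'⟩
    · rintro ⟨k, rfl, hk⟩
      exact (add_mem_graph_right_iff hA hB hS hz ha (R k)).2 ((hRC _ _).2 ⟨k, rfl, hk⟩)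
  · obtain ⟨a, a', u, ha, -, h1, h2⟩ := exists_decomposition hA hB hS hz hg
    exact ⟨a, a', u, ha, h1, h2⟩

include hA hB hS hz in
-- Take R = Q and C = -Q*: then R*w + Ck = Q*(w - k), and injectivity of Q* forces k = w.
theorem exists_isBGeneralizedBoundaryTriple :
    ∃ (T : E →ₗ.[ℂ] E) (Γ₀ Γ₁ : T.domain →ₗ[ℂ] defectSubspace (A ⊓ B)† z),
      IsBGeneralizedBoundaryTriple (A ⊓ B) T Γ₀ Γ₁ ∧
      A = restrictKer T Γ₀ ∧ B = restrictKer T Γ₁ := by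
  let N := defectSubspace (A ⊓ B)† z
  let Q : N →L[ℂ] N := couplingOperator A B z
  have hQinj : Function.Injective Q := couplingOperator_injective hA hB hS hz
  obtain ⟨T, Γ₀, Γ₁, h⟩ := exists_isCoupling (A := A) (z := z) (R := N.subtypeL ∘L Q)
    (C := -adjoint Q) fun a k hak => by
      have := eq_zero_of_add_defectSubspace hA hS hz a (Q k).2 hak
      exact hQinj ((Subtype.ext this : Q k = 0).trans (_root_.map_zero Q).symm)
  have hBT : B = restrictKer T Γ₁ := by
    refine h.eq_restrictKer_one hA hB hS hz fun u w => ?_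
    constructor
    · rintro rfl
      exact ⟨w, rfl, by simp⟩
    · rintro ⟨k, rfl, hk⟩
      have h1 : adjoint Q (w - k) = 0 := by
        rw [_root_.map_sub, sub_eq_add_neg]; exact hk
      have h2 : w - k = 0 := eq_zero_of_forall_inner_couplingOperator hA hB hS hz fun v => by
        rw [← adjoint_inner_right, h1, inner_zero_right]
      rw [sub_eq_zero.1 h2]
  refine ⟨T, Γ₀, Γ₁, h.isBGeneralizedBoundaryTriple hA hB hS (fun k => (Q k).2) hBT ?_,
    h.restrictKer_zero, hBT⟩
  intro k l
  have h1 : ⟪k, Q l⟫ - ⟪Q k, l⟫ = (z - conj z) * ⟪Q k, Q l⟫ :=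
    inner_couplingOperator_sub hA hB hS hz k l
  change ⟪k, -adjoint Q l⟫ - ⟪-adjoint Q k, l⟫ = (z - conj z) * ⟪Q k, Q l⟫
  rw [inner_neg_left, inner_neg_right, adjoint_inner_left, adjoint_inner_right]
  linear_combination h1

/-- A factorization of the coupling operator suited for a double triple. -/
theorem IsCoupling.isDoubleBGeneralizedBoundaryTriple
    {R J : defectSubspace (A ⊓ B)† z →L[ℂ] defectSubspace (A ⊓ B)† z} {c : ℂ} {T : E →ₗ.[ℂ] E}
    {Γ₀ Γ₁ : T.domain →ₗ[ℂ] defectSubspace (A ⊓ B)† z}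
    (hA : IsSelfAdjoint A) (hB : IsSelfAdjoint B)
    (hS : Dense ((A ⊓ B : E →ₗ.[ℂ] E).domain : Set E)) (hz : z.im ≠ 0)
    (hR : IsSelfAdjoint R) (hJ : IsSelfAdjoint J) (hJJ : J * J = 1) (hc : c - conj c = z - conj z)
    (hD : ∀ u w, u = couplingOperator A B z w ↔ u = (R * J * R) (w + c • u))
    (h : IsCoupling A z ((defectSubspace (A ⊓ B)† z).subtypeL ∘L R) (c • (R * R) - J) T Γ₀ Γ₁) :
    IsDoubleBGeneralizedBoundaryTriple (A ⊓ B) T Γ₀ Γ₁ ∧ B = restrictKer T Γ₁ := by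
  have hadj : adjoint R = R := hR
  have hJJ' : ∀ x, J (J x) = x := fun x => DFunLike.congr_fun hJJ x
  have hC : ∀ k, (c • (R * R) - J) k = c • R (R k) - J k := fun k => rfl
  have hBT : B = restrictKer T Γ₁ := by
    refine h.eq_restrictKer_one hA hB hS hz fun u w => ?_
    rw [hD, hadj]
    constructor
    · intro hu
      -- The equation Rw + cR²k - Jk = 0 with u = Rk, solved for k by J² = 1.
      refine ⟨J (R (w + c • u)), hu, ?_⟩
      have h1 : R (J (R (w + c • u))) = u := hu.symm
      rw [hC, hJJ', h1, _root_.map_add, _root_.map_smul]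
      abel
    · rintro ⟨k, rfl, hk⟩
      rw [hC] at hk
      have h1 : J k = R (w + c • R k) := by
        rw [_root_.map_add, _root_.map_smul]
        rw [← sub_eq_zero, ← neg_eq_zero, ← hk]
        abel
      change R k = R (J (R (w + c • R k)))
      rw [← h1, hJJ']
  refine ⟨⟨h.isBGeneralizedBoundaryTriple hA hB hS (fun k => (R k).2) hBT ?_, hBT ▸ hB, ?_⟩, hBT⟩
  · intro k l
    change _ = (z - conj z) * ⟪R k, R l⟫
    have h1 : ⟪J k, l⟫ = ⟪k, J l⟫ := hJ.isSymmetric k l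
    have h2 : ⟪R (R k), l⟫ = ⟪R k, R l⟫ := hR.isSymmetric (R k) l
    have h3 : ⟪R k, R l⟫ = ⟪k, R (R l)⟫ := hR.isSymmetric k (R l)
    rw [hC, hC, inner_sub_left, inner_sub_right, inner_smul_left, inner_smul_right, h1, h2, ← h3]
    linear_combination ⟪R k, R l⟫ * hc
  · intro y
    have hz' : (conj z).im ≠ 0 := by simpa using hz
    -- Then -Jk = y, and a is chosen so that R*(A - z̄)a = -cR²k cancels the other term of Ck.
    let k := -J y
    obtain ⟨a, ha, ha'⟩ := (mem_graph_iff _).1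
      (boundedResolvent_mem_graph hA hz' ((-(c • R k) : defectSubspace (A ⊓ B)† z) : E))
    refine ⟨⟨_, h.mem_domain a k⟩, ?_⟩
    have h1 : A a - conj z • (a : E) = ((-(c • R k) : defectSubspace (A ⊓ B)† z) : E) :=
      sub_eq_iff_eq_add.2 (by rw [ha', ha])
    rw [h.one_apply _ a k rfl, h1, adjoint_comp, Submodule.adjoint_subtypeL, hadj, hC]
    change R ((defectSubspace (A ⊓ B)† z).orthogonalProjectionOnto _) + _ = _
    rw [Submodule.orthogonalProjectionOnto_mem_subspace_eq_self, _root_.map_neg, _root_.map_smul]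
    simp [k, hJJ']

theorem isCompactOperator_couplingOperator
    (hV : IsCompactOperator (boundedResolvent B z - boundedResolvent A z : E →L[ℂ] E)) :
    IsCompactOperator (couplingOperator A B z) :=
  (hV.comp_clm ((1 + (conj z - z) • boundedResolvent A (conj z)) ∘L
    (defectSubspace (A ⊓ B)† z).subtypeL)).clm_comp
      (defectSubspace (A ⊓ B)† z).orthogonalProjectionOnto

/-- The Schatten class of the resolvent difference is inherited by `R M R`. -/
theorem memSchatten_sandwich {p : ℝ≥0∞} (hp : 0 < p)
    (hV : MemSchatten p (boundedResolvent B z - boundedResolvent A z))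
    {R J Y : defectSubspace (A ⊓ B)† z →L[ℂ] defectSubspace (A ⊓ B)† z} (hR : IsSelfAdjoint R)
    (hRR : R ∘L R = J ∘L couplingOperator A B z ∘L Y)
    (M : defectSubspace (A ⊓ B)† z →L[ℂ] defectSubspace (A ⊓ B)† z) :
    MemSchatten p (R ∘L M ∘L R) := by
  have hRc : IsCompactOperator R := by
    refine isCompactOperator_of_sq hR ?_
    rw [hRR]
    exact ((isCompactOperator_couplingOperator hV.1).comp_clm Y).clm_comp J
  let P := (defectSubspace (A ⊓ B)† z).orthogonalProjectionOnto
  let X := (1 + (conj z - z) • boundedResolvent A (conj z)) ∘L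
    (defectSubspace (A ⊓ B)† z).subtypeL
  let c := ‖M‖ * (‖J‖ * (‖P‖ * ‖X‖ * ‖Y‖))
  have hc : 0 ≤ c := by positivity
  -- The factor 2 in the rank comes from the sandwich estimate; c + 1 replaces c because the
  -- constant must be positive.
  refine hV.of_isApproxByRank hp (hRc.comp_clm (M ∘L R)) two_ne_zero
    (c := c + 1) (by positivity) fun n t ht hn => ?_
  have h1 : IsApproxByRank n (‖J‖ * (‖P‖ * (t * ‖X‖) * ‖Y‖)) (R ∘L R) := by
    rw [hRR]
    exact (((hn.comp_right ht.le X).comp_left P).comp_right (by positivity) Y).comp_left J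
  refine (h1.sandwich hR (by positivity) M).mono le_rfl ?_
  have : ‖M‖ * (‖J‖ * (‖P‖ * (t * ‖X‖) * ‖Y‖)) = c * t := by ring
  rw [this]
  linarith

end Intersection

/-! ### Schatten regularity of the Weyl function -/

section Regular

open LinearPMap ContinuousLinearMap
open scoped ComplexConjugate

theorem IsBoundedOp.eq_sub {E : Type u} [NormedAddCommGroup E] [InnerProductSpace ℂ E]
    {K L : E →ₗ.[ℂ] E} {R S V : E →L[ℂ] E} (hK : IsBoundedOp K R) (hL : IsBoundedOp L S)
    (hV : IsBoundedOp (K - L) V) : V = R - S := by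
  rw [IsBoundedOp] at hK hL hV
  subst hK hL
  ext x
  exact (hV.le.2 (x := ⟨x, trivial, trivial⟩) (y := ⟨x, trivial⟩) rfl).symm

variable {E : Type u} [NormedAddCommGroup E] [InnerProductSpace ℂ E] [CompleteSpace E]
variable {A B : E →ₗ.[ℂ] E} {z : ℂ} [CompleteSpace (defectSubspace (A ⊓ B)† z)]

/-- Split M = -J + K. The constant -J is self-adjoint and its own inverse, so K has the same
imaginary part as M and inherits strictness; moreover K(w) has the form R(…)R, so it lies in 𝔖_p. -/
theorem IsCoupling.hasSchattenRegularWeylFunction {p : ℝ≥0∞} (hp : 0 < p)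
    {R J Y : defectSubspace (A ⊓ B)† z →L[ℂ] defectSubspace (A ⊓ B)† z} {c : ℂ} {T : E →ₗ.[ℂ] E}
    {Γ₀ Γ₁ : T.domain →ₗ[ℂ] defectSubspace (A ⊓ B)† z}
    (h : IsCoupling A z ((defectSubspace (A ⊓ B)† z).subtypeL ∘L R) (c • (R * R) - J) T Γ₀ Γ₁)
    (hA : IsSelfAdjoint A) (hR : IsSelfAdjoint R) (hJ : IsSelfAdjoint J) (hJJ : J * J = 1)
    (hc : c - conj c = z - conj z)
    (hV : MemSchatten p (boundedResolvent B z - boundedResolvent A z))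
    (hRR : R ∘L R = J ∘L couplingOperator A B z ∘L Y) :
    HasSchattenRegularWeylFunction p T Γ₀ Γ₁ := by
  let N := defectSubspace (A ⊓ B)† z
  let R' : N →L[ℂ] E := N.subtypeL ∘L R
  let X : ℂ → E →L[ℂ] E := fun w => (w - z) • (1 + (w - conj z) • boundedResolvent A w)
  let M : ℂ → N →L[ℂ] N := fun w => adjoint R' ∘L X w ∘L R' + (c • (R * R) - J)
  let K : ℂ → N →L[ℂ] N := fun w => adjoint R' ∘L X w ∘L R' + c • (R * R)
  have hMK : ∀ w, M w = -J + K w := fun w => by simp only [M, K]; abel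
  have hC : ∀ k l : N, ⟪k, (c • (R * R) - J) l⟫ - ⟪(c • (R * R) - J) k, l⟫ =
      (z - conj z) * ⟪R' k, R' l⟫ := by
    intro k l
    change ⟪k, c • R (R l) - J l⟫ - ⟪c • R (R k) - J k, l⟫ = (z - conj z) * ⟪R k, R l⟫
    have h1 : ⟪J k, l⟫ = ⟪k, J l⟫ := hJ.isSymmetric k l
    have h2 : ⟪R (R k), l⟫ = ⟪R k, R l⟫ := hR.isSymmetric (R k) l
    have h3 : ⟪R k, R l⟫ = ⟪k, R (R l)⟫ := hR.isSymmetric k (R l)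
    rw [inner_sub_left, inner_sub_right, inner_smul_left, inner_smul_right, h1, h2, ← h3]
    linear_combination ⟪R k, R l⟫ * hc
  have hM : ∀ w : ℂ, 0 < w.im → ∀ k, ∃ f : E,
      ⟪k, M w k⟫ - ⟪M w k, k⟫ = (w - conj w) * (‖f‖ : ℂ) ^ 2 ∧ (f = 0 → k = 0) :=
    fun w hw k => h.inner_weyl_sub hA hC hw.ne' k rfl
  have hK : ∀ w : ℂ, 0 < w.im → ∀ k, ∃ f : E,
      ⟪k, K w k⟫ - ⟪K w k, k⟫ = (w - conj w) * (‖f‖ : ℂ) ^ 2 ∧ (f = 0 → k = 0) := by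
    intro w hw k
    obtain ⟨f, hf, hf'⟩ := hM w hw k
    refine ⟨f, ?_, hf'⟩
    have h1 : ⟪J k, k⟫ = ⟪k, J k⟫ := hJ.isSymmetric k k
    have h2 : M w k = -J k + K w k := DFunLike.congr_fun (hMK w) k
    rw [← hf, h2, inner_add_left, inner_add_right, inner_neg_left,
      inner_neg_right, h1]
    ring
  have hKs : IsStrictNevanlinna K := isStrictNevanlinna_of_inner (differentiableOn_weyl hA) hK
  refine ⟨M, fun w hw => h.isBoundedOp_weylFunction hA hw.ne',
    (isStrictNevanlinna_of_inner (differentiableOn_weyl hA) hM).toIsNevanlinna, -J, K, hJ.neg, ?_,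
    hKs, fun w hw => ⟨?_, hMK w⟩⟩
  · exact IsUnit.neg ⟨⟨J, J, hJJ, hJJ⟩, rfl⟩
  · have hKw : K w = R ∘L (N.orthogonalProjectionOnto ∘L X w ∘L N.subtypeL + c • 1) ∘L R := by
      have hadj : adjoint R' = R ∘L N.orthogonalProjectionOnto := by
        rw [adjoint_comp, Submodule.adjoint_subtypeL, show adjoint R = R from hR]
      ext k
      simp only [K, hadj]
      simp [R']
    rw [hKw]
    exact memSchatten_sandwich hp hV hR hRR _

end Regular

end BoundaryTriples

end

open BoundaryTriples LinearPMap in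
theorem mainTheorem9 {E : Type u} [NormedAddCommGroup E] [InnerProductSpace ℂ E] [CompleteSpace E]
    [TopologicalSpace.SeparableSpace E] (A B : E →ₗ.[ℂ] E)
    (hA : IsSelfAdjoint A) (hB : IsSelfAdjoint B)
    (hS : Dense ((A ⊓ B : E →ₗ.[ℂ] E).domain : Set E)) :
    IsGraphDense (A ⊓ B)† (A.domain ⊔ B.domain) ∧
    (∃ (H : Type u) (_ : NormedAddCommGroup H) (_ : InnerProductSpace ℂ H) (_ : CompleteSpace H)
      (T : E →ₗ.[ℂ] E) (Γ₀ Γ₁ : T.domain →ₗ[ℂ] H),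
      IsBGeneralizedBoundaryTriple (A ⊓ B) T Γ₀ Γ₁ ∧
      A = restrictKer T Γ₀ ∧ B = restrictKer T Γ₁) ∧
    (∀ (z : ℂ) (p : ℝ≥0∞), z.im ≠ 0 → 0 < p →
      OpMemSchatten p (resolventOp B z - resolventOp A z) →
      ∃ (H : Type u) (_ : NormedAddCommGroup H) (_ : InnerProductSpace ℂ H) (_ : CompleteSpace H)
        (T : E →ₗ.[ℂ] E) (Γ₀ Γ₁ : T.domain →ₗ[ℂ] H),
        IsDoubleBGeneralizedBoundaryTriple (A ⊓ B) T Γ₀ Γ₁ ∧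
        A = restrictKer T Γ₀ ∧ B = restrictKer T Γ₁ ∧
        HasSchattenRegularWeylFunction p T Γ₀ Γ₁) := by
  have hcs : ∀ z, CompleteSpace (defectSubspace (A ⊓ B)† z) := fun z =>
    (isClosed_defectSubspace hS z).completeSpace_coe
  refine ⟨isGraphDense_sup_domain hA hB hS, ?_, fun z p hz hp hV => ?_⟩
  -- Any nonreal point would do for (i); in (ii) the point is the one at which the resolvent
  -- difference is known to be in 𝔖_p.
  · have := hcs Complex.I
    obtain ⟨T, Γ₀, Γ₁, h⟩ := exists_isBGeneralizedBoundaryTriple hA hB hS (z := Complex.I)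
      (by simp)
    exact ⟨defectSubspace (A ⊓ B)† Complex.I, inferInstance, inferInstance, this, T, Γ₀, Γ₁, h⟩
  · have := hcs z
    obtain ⟨V, hVb, hV⟩ := hV
    rw [(resolventOp_eq hB hz).eq_sub (resolventOp_eq hA hz) hVb] at hV
    have hQ := inner_couplingOperator_sub hA hB hS hz
    have hQ0 := (injective_iff_map_eq_zero _).1 (couplingOperator_injective hA hB hS hz)
    obtain ⟨c, hc, hu⟩ := exists_isUnit_one_add_smul hQ hz
      (isCompactOperator_couplingOperator hV.1)
    obtain ⟨Y, hY, hY0, hYD⟩ := exists_shift hQ hQ0 hc hu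
    obtain ⟨R, J, hR, hR0, hJ, hJJ, hRJR, hRR⟩ := exists_symmetric_factorization hY hY0
    obtain ⟨T, Γ₀, Γ₁, h⟩ := exists_isCoupling (A := A) (z := z)
      (R := (defectSubspace (A ⊓ B)† z).subtypeL ∘L R) (C := c • (R * R) - J)
      fun a k hak => hR0 k (Subtype.ext (eq_zero_of_add_defectSubspace hA hS hz a (R k).2 hak))
    rw [← hRJR] at hYD
    obtain ⟨h1, h2⟩ := h.isDoubleBGeneralizedBoundaryTriple hA hB hS hz hR hJ hJJ hc hYD
    exact ⟨defectSubspace (A ⊓ B)† z, inferInstance, inferInstance, this, T, Γ₀, Γ₁, h1,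
      h.restrictKer_zero, h2, h.hasSchattenRegularWeylFunction hp hA hR hJ hJJ hc hV hRR⟩
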